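/- Let $M$ be a smooth $7$-manifold, $J\subset\mathbb R$ an interval, and $\varphi=\varphi(t)$, $t\in J$, a family of $\mathrm G_2$-structures on $M$, i.e. of smooth positive $3$-forms. (Positive means: at each point there is a basis $e^1,\dots,e^7$ of the cotangent space in which $\varphi=e^{123}-e^{167}-e^{527}-e^{563}-e^{415}-e^{426}-e^{437}$.) In local coordinates $x^1,\dots,x^7$, with summation over repeated indices, let $$B_{ij}\,dx^1\wedge\dots\wedge dx^7=(\partial_i\lrcorner\varphi)\wedge(\partial_j\lrcorner\varphi)\wedge\varphi .$$ The metric $g$ and the volume form $\mathsf{vol}$ determined by $\varphi$ are $$g_{ij}=\frac{1}{6^{2/9}}\,\frac{B_{ij}}{\det(B)^{1/9}},\qquad \mathsf{vol}=-\frac{1}{6^{7/9}}\det(B)^{1/9}\,dx^1\wedge\dots\wedge dx^7$$ (real ninth roots), so that $B_{ij}\,dx^1\wedge\dots\wedge dx^7=-6\,g_{ij}\,\mathsf{vol}$, and $\mathsf{vol}=\sqrt{\det g}\,dx^1\wedge\dots\wedge dx^7$ in coordinates which are positively oriented for the orientation determined by $\varphi$. Let $g^{ij}$ be the inverse matrix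 of $g_{ij}$ and $\psi=*\varphi$ the Hodge dual $4$-form with respect to $g$ and $\mathsf{vol}$. Let $h=h(t)$ be symmetric $2$-tensors and $X=X(t)$ vector fields on $M$; put $h^l_i=g^{lm}h_{mi}$, $h^{ij}=g^{ia}g^{jb}h_{ab}$ and $\operatorname{Tr}_g(h)=g^{ij}h_{ij}$. Suppose that $\varphi$ evolves by the general flow $$\frac{\partial}{\partial t}\varphi_{ijk}=h^l_i\varphi_{ljk}+h^l_j\varphi_{ilk}+h^l_k\varphi_{ijl}+X^l\psi_{lijk}.$$ Then, in every local coordinate system and at every $t\in J$, $$\frac{\partial}{\partial t}B_{ij}=\operatorname{Tr}_g(h)\,B_{ij}+h^l_iB_{lj}+h^l_jB_{il};$$ in particular the evolution of $B_{ij}$ does not depend on the vector field $X$. Consequently $$\frac{\partial}{\partial t}g_{ij}=2h_{ij},\qquad \frac{\partial}{\partial t}g^{ij}=-2h^{ij},\qquad \frac{\partial}{\partial t}\mathsf{vol}=\operatorname{Tr}_g(h)\,\mathsf{vol}.$$ -/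

import Mathlib

open scoped Manifold ContDiff

noncomputable section

namespace G2

/-! ### Linear algebra of alternating forms on one tangent space -/

section LinearAlgebra

variable {V : Type*} [AddCommGroup V] [Module ℝ V]

/-- The wedge product of real-valued alternating forms, normalised so that
`(α ∧ β)(v₁, …, v_{k+l})` is the sum over `(k,l)`-shuffles; in particular
`(dx¹ ∧ … ∧ dxⁿ)(∂₁, …, ∂ₙ) = 1`. -/
def wedge {k l : ℕ} (α : V [⋀^Fin k]→ₗ[ℝ] ℝ) (β : V [⋀^Fin l]→ₗ[ℝ] ℝ) :
    V [⋀^Fin (k + l)]→ₗ[ℝ] ℝ :=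
  ((LinearMap.mul' ℝ ℝ).compAlternatingMap (α.domCoprod β)).domDomCongr finSumFinEquiv

/-- The interior product `u ⌟ α`, that is, `(u ⌟ α)(v₁, …, v_k) = α(u, v₁, …, v_k)`. -/
def interior {k : ℕ} (u : V) (α : V [⋀^Fin (k + 1)]→ₗ[ℝ] ℝ) : V [⋀^Fin k]→ₗ[ℝ] ℝ :=
  α.curryLeft u

/-- The value at `v` of the decomposable form `eⁱ ∧ eʲ ∧ eᵏ`, for the basis `(eⁱ)` of `V*` dual to
the basis `b` of `V`. -/
def dualTriple (b : Module.Basis (Fin 7) ℝ V) (i j k : Fin 7) (v : Fin 3 → V) : ℝ :=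
  Matrix.det (Matrix.of fun p q : Fin 3 => b.coord (![i, j, k] p) (v q))

/-- A `3`-form on a `7`-dimensional space is positive if in some basis it is the standard form
`e¹²³ - e¹⁶⁷ - e⁵²⁷ - e⁵⁶³ - e⁴¹⁵ - e⁴²⁶ - e⁴³⁷`
(the basis is numbered `0, …, 6` in the code). -/
def IsPositive (φ : V [⋀^Fin 3]→ₗ[ℝ] ℝ) : Prop :=
  ∃ b : Module.Basis (Fin 7) ℝ V, ∀ v : Fin 3 → V,
    φ v = dualTriple b 0 1 2 v - dualTriple b 0 5 6 v - dualTriple b 4 1 6 v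
      - dualTriple b 4 5 2 v - dualTriple b 3 0 4 v - dualTriple b 3 1 5 v
      - dualTriple b 3 2 6 v

/-- The components `B_ij` of the `Sym² V* ⊗ Λ⁷ V*`-valued tensor of a `3`-form `φ`, defined by
`B_ij e¹ ∧ … ∧ e⁷ = (b_i ⌟ φ) ∧ (b_j ⌟ φ) ∧ φ`. -/
def tensorB (φ : V [⋀^Fin 3]→ₗ[ℝ] ℝ) (b : Module.Basis (Fin 7) ℝ V) :
    Matrix (Fin 7) (Fin 7) ℝ :=
  Matrix.of fun i j => wedge (wedge (interior (b i) φ) (interior (b j) φ)) φ b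

/-- The real ninth root, `root9 (y ^ 9) = y` for all real `y` (also negative ones). -/
def root9 (x : ℝ) : ℝ := (SignType.sign x : ℝ) * |x| ^ ((1 : ℝ) / 9)

/-- The components `g_ij = 6^(-2/9) B_ij / det(B)^(1/9)` of the metric determined by `φ`. -/
def metric (φ : V [⋀^Fin 3]→ₗ[ℝ] ℝ) (b : Module.Basis (Fin 7) ℝ V) :
    Matrix (Fin 7) (Fin 7) ℝ :=
  Matrix.of fun i j =>
    1 / (6 : ℝ) ^ ((2 : ℝ) / 9) * (tensorB φ b i j / root9 (tensorB φ b).det)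

/-- The volume form determined by `φ`: it is `- 6^(-7/9) det(B)^(1/9) e¹ ∧ … ∧ e⁷`. The
coefficient satisfies `B_ij = -6 g_ij vol(b_1, …, b_7)`; it is `√det(g)` if `b` is positively
oriented for the orientation which `φ` determines, and `-√det(g)` otherwise. -/
def volForm (φ : V [⋀^Fin 3]→ₗ[ℝ] ℝ) (b : Module.Basis (Fin 7) ℝ V) : V [⋀^Fin 7]→ₗ[ℝ] ℝ :=
  (-(1 / (6 : ℝ) ^ ((7 : ℝ) / 9)) * root9 (tensorB φ b).det) • b.det

/-- The components `g^ij` of the inverse metric. -/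
def metricInv (φ : V [⋀^Fin 3]→ₗ[ℝ] ℝ) (b : Module.Basis (Fin 7) ℝ V) :
    Matrix (Fin 7) (Fin 7) ℝ :=
  (metric φ b)⁻¹

/-- The dual `4`-form `ψ = ∗φ`. The Hodge star is given by the usual formula
`(∗φ)_{ijkl} = (1/3!) φ_{pqr} g^{pa} g^{qb} g^{rc} vol_{abcijkl}`, which is the one satisfying
`α ∧ ∗φ = g(α, φ) vol` for all `3`-forms `α`. -/
def dualForm (φ : V [⋀^Fin 3]→ₗ[ℝ] ℝ) (b : Module.Basis (Fin 7) ℝ V) : V [⋀^Fin 4]→ₗ[ℝ] ℝ :=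
  (1 / 6 : ℝ) • ∑ a, ∑ c, ∑ d,
    (∑ p, ∑ q, ∑ r, φ ![b p, b q, b r] *
        (metricInv φ b p a * metricInv φ b q c * metricInv φ b r d)) •
      interior (b d) (interior (b c) (interior (b a) (volForm φ b)))

/-- The components `h_ij` of a `2`-tensor. -/
def tensorComp (h : LinearMap.BilinForm ℝ V) (b : Module.Basis (Fin 7) ℝ V) :
    Matrix (Fin 7) (Fin 7) ℝ :=
  Matrix.of fun i j => h (b i) (b j)

/-- `raiseOne φ h b l i` is `h^l_i = g^{lm} h_{mi}`, for the metric `g` of `φ`. -/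
def raiseOne (φ : V [⋀^Fin 3]→ₗ[ℝ] ℝ) (h : LinearMap.BilinForm ℝ V)
    (b : Module.Basis (Fin 7) ℝ V) (l i : Fin 7) : ℝ :=
  ∑ m, metricInv φ b l m * tensorComp h b m i

/-- `raiseTwo φ h b i j` is `h^{ij} = g^{ip} g^{jq} h_{pq}`, for the metric `g` of `φ`. -/
def raiseTwo (φ : V [⋀^Fin 3]→ₗ[ℝ] ℝ) (h : LinearMap.BilinForm ℝ V)
    (b : Module.Basis (Fin 7) ℝ V) (i j : Fin 7) : ℝ :=
  ∑ p, ∑ q, metricInv φ b i p * metricInv φ b j q * tensorComp h b p q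

/-- `Tr_g(h) = g^{ij} h_{ij}`, for the metric `g` of `φ`. -/
def traceG (φ : V [⋀^Fin 3]→ₗ[ℝ] ℝ) (h : LinearMap.BilinForm ℝ V)
    (b : Module.Basis (Fin 7) ℝ V) : ℝ :=
  ∑ i, ∑ j, metricInv φ b i j * tensorComp h b i j

/-- The right hand side of the general flow equation:
`h^l_i φ_ljk + h^l_j φ_ilk + h^l_k φ_ijl + X^l ψ_lijk`. -/
def flowRHS (φ : V [⋀^Fin 3]→ₗ[ℝ] ℝ) (h : LinearMap.BilinForm ℝ V) (X : V)
    (b : Module.Basis (Fin 7) ℝ V) (i j k : Fin 7) : ℝ :=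
  ∑ l, (raiseOne φ h b l i * φ ![b l, b j, b k] + raiseOne φ h b l j * φ ![b i, b l, b k]
    + raiseOne φ h b l k * φ ![b i, b j, b l]
    + b.repr X l * dualForm φ b ![b l, b i, b j, b k])

end LinearAlgebra

/-! ### `G₂`-structures on a `7`-manifold -/

section Manifold

variable {M : Type*} [TopologicalSpace M] [ChartedSpace (EuclideanSpace ℝ (Fin 7)) M]

/-- A smooth local coordinate system is a diffeomorphism. -/
theorem mdifferentiable_chart {e : OpenPartialHomeomorph M (EuclideanSpace ℝ (Fin 7))}
    (he : e ∈ IsManifold.maximalAtlas (𝓡 7) ∞ M) : e.MDifferentiable (𝓡 7) (𝓡 7) :=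
  ⟨(contMDiffOn_of_mem_maximalAtlas he).mdifferentiableOn (by simp),
    (contMDiffOn_symm_of_mem_maximalAtlas he).mdifferentiableOn (by simp)⟩

variable [IsManifold (𝓡 7) ∞ M]

/-- A `G₂`-structure on a smooth `7`-manifold: a smooth `3`-form which is positive at each point. -/
structure G2Structure (M : Type*) [TopologicalSpace M]
    [ChartedSpace (EuclideanSpace ℝ (Fin 7)) M] [IsManifold (𝓡 7) ∞ M] where
  /-- the underlying `3`-form -/
  toForm : ∀ x : M, TangentSpace (𝓡 7) x [⋀^Fin 3]→L[ℝ] ℝ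
  smooth : ContMDiff (𝓡 7) ((𝓡 7).prod 𝓘(ℝ, EuclideanSpace ℝ (Fin 7) [⋀^Fin 3]→L[ℝ] ℝ)) ∞
    (fun x : M => Bundle.TotalSpace.mk' (EuclideanSpace ℝ (Fin 7) [⋀^Fin 3]→L[ℝ] ℝ)
      (E := fun x : M => TangentSpace (𝓡 7) x [⋀^Fin 3]→L[ℝ] Bundle.Trivial M ℝ x) x (toForm x))
  positive : ∀ x : M, IsPositive (toForm x).toAlternatingMap

/-- The value at `x` of a `G₂`-structure, as an algebraic alternating form. -/
def G2Structure.at (φ : G2Structure M) (x : M) : TangentSpace (𝓡 7) x [⋀^Fin 3]→ₗ[ℝ] ℝ :=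
  (φ.toForm x).toAlternatingMap

/-- The coordinate frame `∂/∂x¹, …, ∂/∂x⁷` at `x` of the local coordinate system `e`: the basis
of the tangent space which the differential of `e` sends to the standard basis of `ℝ⁷`. -/
def coordFrame {e : OpenPartialHomeomorph M (EuclideanSpace ℝ (Fin 7))}
    (he : e ∈ IsManifold.maximalAtlas (𝓡 7) ∞ M) {x : M} (hx : x ∈ e.source) :
    Module.Basis (Fin 7) ℝ (TangentSpace (𝓡 7) x) :=
  (EuclideanSpace.basisFun (Fin 7) ℝ).toBasis.map
    ((mdifferentiable_chart he).mfderiv hx).symm.toLinearEquiv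

/-- The family `φ t`, `t ∈ J`, of `G₂`-structures evolves by the general flow equation
`∂_t φ_ijk = h^l_i φ_ljk + h^l_j φ_ilk + h^l_k φ_ijl + X^l ψ_lijk`
on the domain of the local coordinate system `e`. -/
def IsGeneralFlow {e : OpenPartialHomeomorph M (EuclideanSpace ℝ (Fin 7))}
    (he : e ∈ IsManifold.maximalAtlas (𝓡 7) ∞ M) (J : Set ℝ) (φ : ℝ → G2Structure M)
    (h : ℝ → ∀ x : M, LinearMap.BilinForm ℝ (TangentSpace (𝓡 7) x))
    (X : ℝ → ∀ x : M, TangentSpace (𝓡 7) x) : Prop :=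
  ∀ (x : M) (hx : x ∈ e.source), ∀ t ∈ J, ∀ i j k : Fin 7,
    HasDerivWithinAt
      (fun s => (φ s).at x ![coordFrame he hx i, coordFrame he hx j, coordFrame he hx k])
      (flowRHS ((φ t).at x) (h t x) (X t x) (coordFrame he hx) i j k) J t

end Manifold

end G2

end

/-! ### Algebra of the wedge and interior products. -/

noncomputable section

namespace G2

variable {V W : Type*} [AddCommGroup V] [Module ℝ V] [AddCommGroup W] [Module ℝ W]

/-! The statement is pointwise in `x`, hence linear algebra on one 7-dimensional space. Since wedge
and interior products commute with pullback, `B` is equivariant: pulling `φ` back by `T` replaces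
`B` by `det T • (Tᵀ B T)` (`tensorB_compLinearMap`).

The velocity of the flow is the infinitesimal action on `φ` of an endomorphism `A = H + Y`
(`flowRHS_eq_endAction`). Here `H` is `h` with an index raised. The part `Y` is skew for the metric
and its action on `φ` is `X ⌟ ψ` (`IsPositive.exists_skew`). In a standard frame `Y` is `-1/3` times
the contraction of `X` with `φ`, by the identity `stdPhi_contract`, a finite check. Frame
independence of `ψ` (`dualForm_changeFrame`) transfers this to any frame.

As `B` is polynomial in the components of `φ`, its derivative depends only on the velocity of `φ`.
The flow may thus be replaced by the model curve `r ↦ (1 + rA)^* φ`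
(`hasDerivWithinAt_of_endAction`), where equivariance gives `B' = (tr A) B + Aᵀ B + B A`. Skewness
removes `Y` from every term, so `X` drops out. Moreover `det B` scales by `det(1 + rA)^9`, so its
ninth root has logarithmic derivative `tr A`. Dividing leaves `g' = Aᵀ g + g A = 2h`, and the
remaining formulas follow. -/

theorem wedge_eq_domCoprod' {k l : ℕ} (α : V [⋀^Fin k]→ₗ[ℝ] ℝ) (β : V [⋀^Fin l]→ₗ[ℝ] ℝ) :
    wedge α β = ((LinearMap.mul' ℝ ℝ).compAlternatingMap
      (AlternatingMap.domCoprod' (α ⊗ₜ[ℝ] β))).domDomCongr finSumFinEquiv := rfl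

theorem wedge_add_left {k l : ℕ} (α α' : V [⋀^Fin k]→ₗ[ℝ] ℝ) (β : V [⋀^Fin l]→ₗ[ℝ] ℝ) :
    wedge (α + α') β = wedge α β + wedge α' β := by
  ext v; simp [wedge_eq_domCoprod', TensorProduct.add_tmul, -AlternatingMap.domCoprod'_apply]

theorem wedge_add_right {k l : ℕ} (α : V [⋀^Fin k]→ₗ[ℝ] ℝ) (β β' : V [⋀^Fin l]→ₗ[ℝ] ℝ) :
    wedge α (β + β') = wedge α β + wedge α β' := by
  ext v; simp [wedge_eq_domCoprod', TensorProduct.tmul_add, -AlternatingMap.domCoprod'_apply]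

theorem wedge_smul_left {k l : ℕ} (c : ℝ) (α : V [⋀^Fin k]→ₗ[ℝ] ℝ) (β : V [⋀^Fin l]→ₗ[ℝ] ℝ) :
    wedge (c • α) β = c • wedge α β := by
  ext v
  simp [wedge_eq_domCoprod', ← TensorProduct.smul_tmul', -AlternatingMap.domCoprod'_apply]

theorem wedge_smul_right {k l : ℕ} (c : ℝ) (α : V [⋀^Fin k]→ₗ[ℝ] ℝ) (β : V [⋀^Fin l]→ₗ[ℝ] ℝ) :
    wedge α (c • β) = c • wedge α β := by
  ext v; simp [wedge_eq_domCoprod', -AlternatingMap.domCoprod'_apply]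

/-- The wedge product as a bilinear map. -/
def wedgeBilin (k l : ℕ) : (V [⋀^Fin k]→ₗ[ℝ] ℝ) →ₗ[ℝ] (V [⋀^Fin l]→ₗ[ℝ] ℝ) →ₗ[ℝ]
    (V [⋀^Fin (k + l)]→ₗ[ℝ] ℝ) :=
  LinearMap.mk₂ ℝ wedge wedge_add_left wedge_smul_left wedge_add_right wedge_smul_right

/-- The wedge product as a normalised sum over all permutations. -/
theorem wedge_apply {k l : ℕ} (α : V [⋀^Fin k]→ₗ[ℝ] ℝ) (β : V [⋀^Fin l]→ₗ[ℝ] ℝ)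
    (v : Fin (k + l) → V) :
    wedge α β v = ((k.factorial * l.factorial : ℕ) : ℝ)⁻¹ *
      ∑ σ : Equiv.Perm (Fin k ⊕ Fin l), ((Equiv.Perm.sign σ : ℤ) : ℝ) *
        (α (fun p => v (finSumFinEquiv (σ (Sum.inl p)))) *
          β (fun p => v (finSumFinEquiv (σ (Sum.inr p))))) := by
  have h := congrArg (fun η => LinearMap.mul' ℝ ℝ (η (fun p => v (finSumFinEquiv p))))
    (MultilinearMap.domCoprod_alternization_eq α β)
  have h0 : ((k.factorial * l.factorial : ℕ) : ℝ) ≠ 0 :=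
    Nat.cast_ne_zero.mpr (Nat.mul_ne_zero k.factorial_ne_zero l.factorial_ne_zero)
  rw [eq_inv_mul_iff_mul_eq₀ h0]
  simp only [Fintype.card_fin] at h
  refine Eq.trans (Eq.trans ?_ h.symm) ?_
  · exact ((map_nsmul (LinearMap.mul' ℝ ℝ) _ _).trans (nsmul_eq_mul _ _)).symm
  simp only [MultilinearMap.alternatization_apply, map_sum]
  refine Finset.sum_congr rfl fun σ _ => ?_
  rw [Units.smul_def, map_zsmul, zsmul_eq_mul]
  simp

theorem wedge_compLinearMap {k l : ℕ} (α : V [⋀^Fin k]→ₗ[ℝ] ℝ) (β : V [⋀^Fin l]→ₗ[ℝ] ℝ)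
    (T : W →ₗ[ℝ] V) :
    wedge (α.compLinearMap T) (β.compLinearMap T) = (wedge α β).compLinearMap T := by
  ext v; simp [wedge_apply]

theorem interior_compLinearMap {k : ℕ} (α : V [⋀^Fin (k + 1)]→ₗ[ℝ] ℝ) (T : W →ₗ[ℝ] V) (u : W) :
    interior u (α.compLinearMap T) = (interior (T u) α).compLinearMap T :=
  AlternatingMap.curryLeft_compLinearMap T α u

/-! ### Decomposable forms in a frame -/

variable (b : Module.Basis (Fin 7) ℝ V)

/-- The decomposable form `e^{x₁} ∧ … ∧ e^{x_k}` of the coframe dual to `b`. -/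
def coordForm {k : ℕ} (x : Fin k → Fin 7) : V [⋀^Fin k]→ₗ[ℝ] ℝ :=
  MultilinearMap.alternatization
    ((MultilinearMap.mkPiAlgebra ℝ (Fin k) ℝ).compLinearMap fun p => b.coord (x p))

theorem coordForm_apply {k : ℕ} (x : Fin k → Fin 7) (v : Fin k → V) :
    coordForm b x v = Matrix.det (Matrix.of fun p q => b.coord (x p) (v q)) := by
  rw [← Matrix.det_transpose, Matrix.det_apply]
  simp [coordForm, MultilinearMap.alternatization_apply]

/-- Both factors are alternatizations of products of coordinates, and the shuffle normalisation
makes their wedge the alternatization of the joint product, with no factorial left over. -/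
theorem wedge_coordForm {k l : ℕ} (x : Fin k → Fin 7) (y : Fin l → Fin 7) :
    wedge (coordForm b x) (coordForm b y) = coordForm b (Fin.append x y) := by
  ext v
  rw [coordForm_apply, ← Matrix.det_submatrix_equiv_self finSumFinEquiv,
    ← Matrix.det_transpose, Matrix.det_apply]
  unfold wedge coordForm
  rw [← MultilinearMap.domCoprod_alternization]
  simp only [AlternatingMap.domDomCongr_apply, LinearMap.compAlternatingMap_apply,
    MultilinearMap.alternatization_apply, map_sum]
  refine Finset.sum_congr rfl fun σ _ => ?_
  rw [Units.smul_def, Units.smul_def]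
  refine Eq.trans (map_zsmul (LinearMap.mul' ℝ ℝ) _ _) ?_
  congr 1
  simp

/-! ### Equivariance of `B` under change of frame and pullback. -/

/-- The form `(u ⌟ φ) ∧ (w ⌟ φ) ∧ φ`. -/
def pairing (φ : V [⋀^Fin 3]→ₗ[ℝ] ℝ) (u w : V) : V [⋀^Fin 7]→ₗ[ℝ] ℝ :=
  wedge (wedge (interior u φ) (interior w φ)) φ

theorem tensorB_apply (φ : V [⋀^Fin 3]→ₗ[ℝ] ℝ) (i j : Fin 7) :
    tensorB φ b i j = pairing φ (b i) (b j) b := by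
  unfold tensorB pairing
  rw [Matrix.of_apply]

/-- `pairing` as a bilinear map. -/
def pairingBilin (φ : V [⋀^Fin 3]→ₗ[ℝ] ℝ) : V →ₗ[ℝ] V →ₗ[ℝ] V [⋀^Fin 7]→ₗ[ℝ] ℝ :=
  have hadd (u u' : V) : interior (u + u') φ = interior u φ + interior u' φ := map_add _ u u'
  have hsmul (c : ℝ) (u : V) : interior (c • u) φ = c • interior u φ := map_smul _ c u
  LinearMap.mk₂ ℝ (pairing φ)
    (fun u u' w => by unfold pairing; rw [hadd, wedge_add_left, wedge_add_left])
    (fun c u w => by unfold pairing; rw [hsmul, wedge_smul_left, wedge_smul_left])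
    (fun u w w' => by unfold pairing; rw [hadd, wedge_add_right, wedge_add_left])
    (fun c u w => by unfold pairing; rw [hsmul, wedge_smul_right, wedge_smul_left])

theorem pairingBilin_apply (φ : V [⋀^Fin 3]→ₗ[ℝ] ℝ) (u w : V) :
    pairingBilin φ u w = pairing φ u w :=
  LinearMap.mk₂_apply ..

theorem pairing_compLinearMap (φ : V [⋀^Fin 3]→ₗ[ℝ] ℝ) (T : W →ₗ[ℝ] V) (u w : W) :
    pairing (φ.compLinearMap T) u w = (pairing φ (T u) (T w)).compLinearMap T := by
  unfold pairing
  rw [interior_compLinearMap, interior_compLinearMap, wedge_compLinearMap, wedge_compLinearMap]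

theorem bilin_apply_frame (R : V →ₗ[ℝ] V →ₗ[ℝ] V [⋀^Fin 7]→ₗ[ℝ] ℝ) (v : Fin 7 → V)
    (i j : Fin 7) (w : Fin 7 → V) :
    R (v i) (v j) w = ((b.toMatrix v).transpose * Matrix.of (fun k l => R (b k) (b l) w) *
      b.toMatrix v) i j := by
  let ev : (V [⋀^Fin 7]→ₗ[ℝ] ℝ) →ₗ[ℝ] ℝ :=
    { toFun := fun η => η w, map_add' := fun _ _ => rfl, map_smul' := fun _ _ => rfl }
  have hQ (u u' : V) : R.compr₂ ev u u' = R u u' w := LinearMap.compr₂_apply ..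
  rw [← hQ]
  conv_lhs => rw [← b.sum_toMatrix_smul_self v i, ← b.sum_toMatrix_smul_self v j]
  simp only [map_sum, map_smul, LinearMap.sum_apply, LinearMap.smul_apply, Matrix.mul_apply,
    Matrix.transpose_apply, Finset.sum_mul, hQ, smul_eq_mul, Finset.mul_sum, Matrix.of_apply]
  refine Finset.sum_congr rfl fun k _ => Finset.sum_congr rfl fun l _ => ?_
  ring

theorem tensorB_eq_of (φ : V [⋀^Fin 3]→ₗ[ℝ] ℝ) :
    tensorB φ b = Matrix.of fun i j => pairing φ (b i) (b j) b := by
  ext i j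
  rw [tensorB_apply, Matrix.of_apply]

theorem pairing_apply_frame (φ : V [⋀^Fin 3]→ₗ[ℝ] ℝ) (v : Fin 7 → V) (i j : Fin 7) :
    pairing φ (v i) (v j) b = ((b.toMatrix v).transpose *
      Matrix.of (fun i j => pairing φ (b i) (b j) b) * b.toMatrix v) i j := by
  have hR := pairingBilin_apply φ
  have := bilin_apply_frame b (pairingBilin φ) v i j b
  simp only [hR] at this
  exact this

/-- Forms of top degree are multiples of `b.det`. The family `v` need not be a basis, which later
allows pullback by singular maps. -/
theorem pairing_apply_eq_det_mul (φ : V [⋀^Fin 3]→ₗ[ℝ] ℝ) (v : Fin 7 → V) (i j : Fin 7) :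
    pairing φ (v i) (v j) v = b.det v * pairing φ (v i) (v j) b := by
  rw [(pairing φ (v i) (v j)).eq_smul_basis_det b, AlternatingMap.smul_apply, smul_eq_mul,
    mul_comm, AlternatingMap.smul_apply, b.det_self, smul_eq_mul, mul_one]

theorem pairing_apply (φ : V [⋀^Fin 3]→ₗ[ℝ] ℝ) (v : Fin 7 → V) (i j : Fin 7) :
    pairing φ (v i) (v j) v =
      b.det v * ((b.toMatrix v).transpose * tensorB φ b * b.toMatrix v) i j := by
  rw [pairing_apply_eq_det_mul, pairing_apply_frame, tensorB_eq_of]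

theorem tensorB_changeFrame (φ : V [⋀^Fin 3]→ₗ[ℝ] ℝ) (b' : Module.Basis (Fin 7) ℝ V) :
    tensorB φ b' = b.det b' • ((b.toMatrix b').transpose * tensorB φ b * b.toMatrix b') := by
  ext i j
  rw [tensorB_apply, pairing_apply b]; rfl

/-- The determinant comes from the seven arguments of the top form, the two matrix factors from the
two contracted vectors. No invertibility of `T` is needed, so the formula applies to `1 + rA` for
every `r`. -/
theorem tensorB_compLinearMap (φ : V [⋀^Fin 3]→ₗ[ℝ] ℝ) (T : V →ₗ[ℝ] V) :
    tensorB (φ.compLinearMap T) b = (LinearMap.toMatrix b b T).det •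
      ((LinearMap.toMatrix b b T).transpose * tensorB φ b * LinearMap.toMatrix b b T) := by
  ext i j
  rw [tensorB_apply, pairing_compLinearMap]
  have h : b.toMatrix (fun i => T (b i)) = LinearMap.toMatrix b b T := by
    ext k l; simp [Module.Basis.toMatrix_apply, LinearMap.toMatrix_apply]
  have := pairing_apply b φ (fun i => T (b i)) i j
  rw [Module.Basis.det_apply, h] at this
  rw [AlternatingMap.compLinearMap_apply, Matrix.smul_apply, smul_eq_mul, ← this]

/-! ### Components -/

/-- The components of `tensorB` are differentiable functions of the components of the `3`-form. -/
theorem exists_tensorB_eq (i j : Fin 7) : ∃ F : ((Fin 3 → Fin 7) → ℝ) → ℝ, Differentiable ℝ F ∧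
    ∀ φ : V [⋀^Fin 3]→ₗ[ℝ] ℝ, tensorB φ b i j = F fun x => φ fun p => b (x p) := by
  have hi (i : Fin 7) (φ : V [⋀^Fin 3]→ₗ[ℝ] ℝ) (x : Fin 2 → Fin 7) :
      interior (b i) φ (fun p => b (x p)) =
        φ (fun p => b ((Matrix.vecCons i x : Fin 3 → Fin 7) p)) := by
    refine congrArg φ (funext fun p => ?_)
    cases p using Fin.cases <;> rfl
  let e : Fin 4 ⊕ Fin 3 ≃ Fin 7 := finSumFinEquiv
  let e' : Fin 2 ⊕ Fin 2 ≃ Fin 4 := finSumFinEquiv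
  -- The witness is the double permutation sum of `wedge_apply`: a cubic polynomial in the
  -- components, each contracted index being prepended to two frame indices.
  refine ⟨fun c => (((2 + 2).factorial * (3).factorial : ℕ) : ℝ)⁻¹ *
    ∑ σ : Equiv.Perm (Fin 4 ⊕ Fin 3), ((Equiv.Perm.sign σ : ℤ) : ℝ) *
      ((((2).factorial * (2).factorial : ℕ) : ℝ)⁻¹ *
        (∑ τ : Equiv.Perm (Fin 2 ⊕ Fin 2), ((Equiv.Perm.sign τ : ℤ) : ℝ) *
          (c (Matrix.vecCons i fun p => e (σ (Sum.inl (e' (τ (Sum.inl p)))))) *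
            c (Matrix.vecCons j fun p => e (σ (Sum.inl (e' (τ (Sum.inr p)))))))) *
        c fun p => e (σ (Sum.inr p))), ?_, fun φ => ?_⟩
  · fun_prop
  · unfold tensorB
    rw [Matrix.of_apply]
    refine Eq.trans (wedge_apply (wedge (interior (b i) φ) (interior (b j) φ)) φ b) ?_
    congr 1
    refine Finset.sum_congr rfl fun σ _ => ?_
    congr 2
    refine (wedge_apply (interior (b i) φ) (interior (b j) φ) _).trans ?_
    congr 1
    refine Finset.sum_congr rfl fun τ _ => ?_
    rw [hi i φ fun p => e (σ (Sum.inl (e' (τ (Sum.inl p))))),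
      hi j φ fun p => e (σ (Sum.inl (e' (τ (Sum.inr p)))))]

end G2

end

noncomputable section

namespace G2

/-! ### Signs of index lists -/

/-- `(-1) ^ N` for the number `N` of elements of a list which are smaller than `a`, and zero if `a`
is in the list. -/
def signAgainst (a : Fin 7) : List (Fin 7) → ℤ
  | [] => 1
  | c :: l => if a < c then signAgainst a l else if c < a then -signAgainst a l else 0

/-- The Levi-Civita symbol of a list of indices. -/
def epsList : List (Fin 7) → ℤ
  | [] => 1
  | a :: l => if epsList l = 0 then 0 else signAgainst a l * epsList l

/-- The sign of `c - a`. -/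
def signDiff (a c : Fin 7) : ℤ := if a < c then 1 else if c < a then -1 else 0

theorem signAgainst_cons (a c : Fin 7) (l : List (Fin 7)) :
    signAgainst a (c :: l) = signDiff a c * signAgainst a l := by
  rw [signAgainst, signDiff]; split_ifs <;> simp

/-- The test for zero in `epsList` is an evaluation shortcut without mathematical content. -/
theorem epsList_cons (a : Fin 7) (l : List (Fin 7)) :
    epsList (a :: l) = signAgainst a l * epsList l := by
  rw [epsList]; split_ifs with h <;> simp [h]

/-- For injective `x` this is a permutation matrix, whose sign is the product of the signs of `x j -
x i` over `i < j`. For a repeated index the determinant has equal rows and the product has a zero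
factor. -/
theorem det_delta (x : Fin 7 → Fin 7) :
    Matrix.det (Matrix.of fun p q => if x p = q then (1 : ℝ) else 0) =
      (epsList [x 0, x 1, x 2, x 3, x 4, x 5, x 6] : ℤ) := by
  have h1 : Matrix.det (Matrix.of fun p q => if x p = q then (1 : ℝ) else 0) =
      ((∏ i, ∏ j ∈ Finset.Ioi i, signDiff (x i) (x j) : ℤ) : ℝ) := by
    by_cases hx : Function.Injective x
    · let σ : Equiv.Perm (Fin 7) := Equiv.ofBijective x (Finite.injective_iff_bijective.1 hx)
      have hM : (Matrix.of fun p q => if x p = q then (1 : ℝ) else 0) = σ.permMatrix ℝ := by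
        ext p q
        simp [σ, Equiv.Perm.permMatrix, PEquiv.toMatrix_apply, eq_comm]
      rw [hM, Matrix.det_permutation, σ.sign_eq_prod_prod_Ioi]
      push_cast
      refine Finset.prod_congr rfl fun i _ => Finset.prod_congr rfl fun j hj => ?_
      have hij : x i ≠ x j := hx.ne (Finset.mem_Ioi.1 hj).ne
      simp only [σ, Equiv.ofBijective_apply, signDiff]
      rcases lt_or_gt_of_ne hij with h | h
      · simp [h]
      · simp [h, h.not_gt]
    · obtain ⟨i, j, hij, hne⟩ : ∃ i j, x i = x j ∧ i ≠ j := by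
        simpa [Function.Injective] using hx
      rw [Matrix.det_zero_of_row_eq hne (by ext q; simp [hij])]
      symm
      rw [Int.cast_eq_zero]
      wlog h : i < j generalizing i j
      · exact this j i hij.symm hne.symm (lt_of_le_of_ne (not_lt.1 h) hne.symm)
      exact Finset.prod_eq_zero (Finset.mem_univ i)
        (Finset.prod_eq_zero (Finset.mem_Ioi.2 h) (by simp [signDiff, hij]))
  have h2 (i : Fin 7) : ∏ j ∈ Finset.Ioi i, signDiff (x i) (x j) =
      ∏ j, if i < j then signDiff (x i) (x j) else 1 := by
    rw [← Finset.prod_filter]; congr 1; ext; simp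
  rw [h1]
  simp only [h2, Fin.prod_univ_seven, epsList_cons, signAgainst_cons]
  simp [signAgainst, epsList]
  ring

variable {V : Type*} [AddCommGroup V] [Module ℝ V] (b : Module.Basis (Fin 7) ℝ V)

theorem coordForm_self (x : Fin 7 → Fin 7) : coordForm b x b = b.det fun p => b (x p) := by
  rw [coordForm_apply, Module.Basis.det_apply, ← Matrix.det_transpose]
  congr 1
  ext p q
  simp [Module.Basis.toMatrix_apply, Finsupp.single_apply, eq_comm]

theorem det_basis (x : Fin 7 → Fin 7) :
    b.det (fun p => b (x p)) = (epsList [x 0, x 1, x 2, x 3, x 4, x 5, x 6] : ℤ) := by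
  rw [Module.Basis.det_apply, ← Matrix.det_transpose, ← det_delta]
  congr 1
  ext p q
  simp [Module.Basis.toMatrix_apply, Finsupp.single_apply]

/-- Bridges the degree `2 + 2 + 3` produced by the wedge products and the degree `7` of `b.det`. -/
theorem coordForm_cast {k : ℕ} (hk : k = 7) (x : Fin k → Fin 7) (v : Fin k → V)
    (hv : ∀ p, v p = b (Fin.cast hk p)) (y : Fin 7 → Fin 7)
    (hy : ∀ p, y p = x (Fin.cast hk.symm p)) :
    coordForm b x v = b.det fun p => b (y p) := by
  subst hk
  obtain rfl : v = b := funext hv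
  obtain rfl : y = x := funext hy
  exact coordForm_self b y

/-! ### The standard positive form -/

/-- The index triples of the standard positive form. -/
def stdTriple : Fin 7 → Fin 3 → Fin 7 :=
  ![![0, 1, 2], ![0, 5, 6], ![4, 1, 6], ![4, 5, 2], ![3, 0, 4], ![3, 1, 5], ![3, 2, 6]]

/-- The coefficients of the standard positive form. -/
def stdCoeff : Fin 7 → ℤ := ![1, -1, -1, -1, -1, -1, -1]

/-- The standard positive form in the frame `b`. -/
def stdForm : V [⋀^Fin 3]→ₗ[ℝ] ℝ := ∑ s, (stdCoeff s : ℝ) • coordForm b (stdTriple s)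

theorem IsPositive.exists_eq_stdForm {φ : V [⋀^Fin 3]→ₗ[ℝ] ℝ} (h : IsPositive φ) :
    ∃ b : Module.Basis (Fin 7) ℝ V, φ = stdForm b := by
  obtain ⟨b, hb⟩ := h
  refine ⟨b, AlternatingMap.ext fun v => ?_⟩
  have hd (i j k : Fin 7) : dualTriple b i j k v = coordForm b ![i, j, k] v := by
    rw [coordForm_apply]; rfl
  rw [hb, stdForm]
  simp only [hd, Fin.sum_univ_seven, AlternatingMap.add_apply, AlternatingMap.smul_apply]
  simp [stdCoeff, stdTriple]
  ring

/-- Laplace expansion along the first column, in which `b i` has a unit coordinate vector. -/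
theorem interior_coordForm (i : Fin 7) (x : Fin 3 → Fin 7) :
    interior (b i) (coordForm b x) =
      ∑ p : Fin 3, (((if x p = i then (-1) ^ (p : ℕ) else 0 : ℤ)) : ℝ) •
        coordForm b fun q => x (p.succAbove q) := by
  ext v
  have h : interior (b i) (coordForm b x) v = coordForm b x (Matrix.vecCons (b i) v) := rfl
  rw [h]
  simp only [Fin.sum_univ_three, AlternatingMap.add_apply, AlternatingMap.smul_apply,
    coordForm_apply]
  rw [Matrix.det_succ_column_zero]
  simp [Fin.sum_univ_three, Matrix.submatrix, Finsupp.single_apply, eq_comm]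

/-- The components of `tensorB` of the standard form. -/
def stdB (i j : Fin 7) : ℤ :=
  ∑ r, stdCoeff r * ∑ t, ∑ q, if stdTriple t q = j then stdCoeff t * (-1) ^ (q : ℕ) *
    ∑ s, ∑ p, if stdTriple s p = i then stdCoeff s * (-1) ^ (p : ℕ) *
      epsList [stdTriple s (p.succAbove 0), stdTriple s (p.succAbove 1),
        stdTriple t (q.succAbove 0), stdTriple t (q.succAbove 1),
        stdTriple r 0, stdTriple r 1, stdTriple r 2] else 0 else 0

/-- A finite integer computation; it is the origin of the constant in `B = -6 g vol`. -/
theorem stdB_eq : ∀ i j, stdB i j = if i = j then -6 else 0 := by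
  decide +kernel

theorem form_sum_apply {ι : Type*} {k : ℕ} (S : Finset ι) (f : ι → V [⋀^Fin k]→ₗ[ℝ] ℝ)
    (v : Fin k → V) : (∑ i ∈ S, f i) v = ∑ i ∈ S, f i v := by
  let ev : (V [⋀^Fin k]→ₗ[ℝ] ℝ) →ₗ[ℝ] ℝ :=
    { toFun := fun η => η v, map_add' := fun _ _ => rfl, map_smul' := fun _ _ => rfl }
  exact map_sum ev f S

theorem wedge_sum_left {ι : Type*} {k l : ℕ} (S : Finset ι) (f : ι → V [⋀^Fin k]→ₗ[ℝ] ℝ)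
    (β : V [⋀^Fin l]→ₗ[ℝ] ℝ) : wedge (∑ i ∈ S, f i) β = ∑ i ∈ S, wedge (f i) β :=
  map_sum ((wedgeBilin k l).flip β) f S

theorem wedge_sum_right {ι : Type*} {k l : ℕ} (S : Finset ι) (α : V [⋀^Fin k]→ₗ[ℝ] ℝ)
    (f : ι → V [⋀^Fin l]→ₗ[ℝ] ℝ) : wedge α (∑ i ∈ S, f i) = ∑ i ∈ S, wedge α (f i) :=
  map_sum (wedgeBilin k l α) f S

theorem interior_stdForm (i : Fin 7) :
    interior (b i) (stdForm b) = ∑ s, ∑ p : Fin 3,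
      ((if stdTriple s p = i then stdCoeff s * (-1) ^ (p : ℕ) else 0 : ℤ) : ℝ) •
        coordForm b fun q => stdTriple s (p.succAbove q) := by
  have h : interior (b i) (stdForm b) =
      ∑ s, (stdCoeff s : ℝ) • interior (b i) (coordForm b (stdTriple s)) := by
    ext v
    have hc (η : V [⋀^Fin 3]→ₗ[ℝ] ℝ) : interior (b i) η v = η (Matrix.vecCons (b i) v) := rfl
    rw [hc, stdForm, form_sum_apply, form_sum_apply]
    rfl
  rw [h]
  simp only [interior_coordForm, Finset.smul_sum, smul_smul]
  refine Finset.sum_congr rfl fun s _ => Finset.sum_congr rfl fun p _ => ?_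
  congr 1
  split_ifs <;> simp

theorem wedge_wedge_coordForm_self (x y : Fin 2 → Fin 7) (z : Fin 3 → Fin 7) :
    wedge (wedge (coordForm b x) (coordForm b y)) (coordForm b z) b =
      (epsList [x 0, x 1, y 0, y 1, z 0, z 1, z 2] : ℤ) := by
  rw [wedge_coordForm, wedge_coordForm]
  let X : Fin 7 → Fin 7 := fun p => Fin.append (Fin.append x y) z (Fin.cast rfl p)
  have h := det_basis b X
  have h0 : X 0 = x 0 := rfl
  have h1 : X 1 = x 1 := rfl
  have h2 : X 2 = y 0 := rfl
  have h3 : X 3 = y 1 := rfl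
  have h4 : X 4 = z 0 := rfl
  have h5 : X 5 = z 1 := rfl
  have h6 : X 6 = z 2 := rfl
  rw [h0, h1, h2, h3, h4, h5, h6] at h
  rw [← h]
  exact coordForm_cast (k := 2 + 2 + 3) b rfl _ b (fun _ => rfl) X fun _ => rfl

theorem tensorB_stdForm : tensorB (stdForm b) b = (-6 : ℝ) • (1 : Matrix (Fin 7) (Fin 7) ℝ) := by
  ext i j
  have h : tensorB (stdForm b) b i j = (stdB i j : ℤ) := by
    unfold tensorB
    rw [Matrix.of_apply, interior_stdForm, interior_stdForm]
    conv_lhs => rw [stdForm]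
    simp only [wedge_sum_left, wedge_sum_right, wedge_smul_left, wedge_smul_right,
      form_sum_apply, AlternatingMap.smul_apply, wedge_wedge_coordForm_self]
    have hl (P : Prop) [Decidable P] (c z : ℤ) :
        ((if P then c * z else 0 : ℤ) : ℝ) = ((if P then c else 0 : ℤ) : ℝ) * (z : ℝ) := by
      split_ifs <;> simp
    unfold stdB
    simp only [smul_eq_mul, Int.cast_sum, Int.cast_mul (stdCoeff _) (Finset.sum _ _), hl]
  rw [h, stdB_eq]
  by_cases hij : i = j <;> simp [hij]

/-! ### The metric, the volume form and the dual form in a standard frame -/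

/-- Valid for negative `x` because 9 is odd; this lets frame changes reverse the orientation. -/
theorem root9_pow_mul (x y : ℝ) : root9 (x ^ 9 * y) = x * root9 y := by
  have h : |x ^ 9| ^ ((1 : ℝ) / 9) = |x| := by
    rw [abs_pow, ← Real.rpow_natCast, ← Real.rpow_mul (abs_nonneg x)]
    norm_num
  unfold root9
  rw [abs_mul, Real.mul_rpow (abs_nonneg _) (abs_nonneg _), h, sign_mul, sign_pow]
  rcases lt_trichotomy x 0 with hx | hx | hx
  · simp [sign_neg hx, abs_of_neg hx, Odd.neg_one_pow (by decide : Odd 9)]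
    ring
  · simp [hx]
  · simp [sign_pos hx, abs_of_pos hx]; ring

theorem root9_det_tensorB_stdForm :
    root9 (tensorB (stdForm b) b).det = -(6 : ℝ) ^ ((7 : ℝ) / 9) := by
  rw [tensorB_stdForm, Matrix.det_smul, Matrix.det_one, mul_one, Fintype.card_fin]
  have h : ((-6 : ℝ) ^ 7) = -(6 ^ 7) := by norm_num
  unfold root9
  rw [h, sign_neg (by norm_num), abs_neg, abs_of_pos (by norm_num), ← Real.rpow_natCast,
    ← Real.rpow_mul (by norm_num)]
  norm_num

/-- The minus signs of `B = -6` and of the root of `(-6)^7` cancel, and the exponents `2/9` and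
`7/9` add up to 1. A standard frame is therefore orthonormal. -/
theorem metric_stdForm : metric (stdForm b) b = 1 := by
  ext i j
  have h : (6 : ℝ) ^ ((2 : ℝ) / 9) * (6 : ℝ) ^ ((7 : ℝ) / 9) = 6 := by
    rw [← Real.rpow_add (by norm_num)]; norm_num
  have h1 : (6 : ℝ) ^ ((2 : ℝ) / 9) ≠ 0 := by positivity
  have h2 : (6 : ℝ) ^ ((7 : ℝ) / 9) ≠ 0 := by positivity
  unfold metric
  rw [Matrix.of_apply, root9_det_tensorB_stdForm, tensorB_stdForm, Matrix.smul_apply,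
    smul_eq_mul]
  field_simp
  rw [mul_right_comm, h]

theorem metricInv_stdForm : metricInv (stdForm b) b = 1 := by
  rw [metricInv, metric_stdForm, inv_one]

theorem volForm_stdForm : volForm (stdForm b) b = b.det := by
  have h2 : (6 : ℝ) ^ ((7 : ℝ) / 9) ≠ 0 := by positivity
  unfold volForm
  rw [root9_det_tensorB_stdForm]
  have : -(1 / (6 : ℝ) ^ ((7 : ℝ) / 9)) * -(6 : ℝ) ^ ((7 : ℝ) / 9) = 1 := by field_simp
  rw [this, one_smul]

theorem interior_apply {k : ℕ} (u : V) (η : V [⋀^Fin (k + 1)]→ₗ[ℝ] ℝ) (v : Fin k → V) :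
    interior u η v = η (Matrix.vecCons u v) := rfl

/-- Polarization of the vanishing of a repeated contraction. -/
theorem interior_interior_comm {k : ℕ} (u w : V) (η : V [⋀^Fin (k + 2)]→ₗ[ℝ] ℝ) :
    interior u (interior w η) = -interior w (interior u η) := by
  have h (u : V) : interior u (interior u η) = 0 := AlternatingMap.curryLeft_same η u
  have hl (u w u' : V) : interior u' (interior (u + w) η) =
      interior u' (interior u η) + interior u' (interior w η) := by
    unfold interior; rw [map_add, AlternatingMap.curryLeft_add]; rfl
  have hr (u w u' : V) : interior (u + w) (interior u' η) =
      interior u (interior u' η) + interior w (interior u' η) := map_add _ u w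
  have := h (u + w)
  rw [hl, hr, hr, h, h, zero_add, add_zero] at this
  exact eq_neg_of_add_eq_zero_right this

theorem coordForm_triple (x : Fin 3 → Fin 7) (a c d : Fin 7) :
    coordForm b x ![b a, b c, b d] =
      (if x 0 = a then (1 : ℝ) else 0) * (if x 1 = c then (1 : ℝ) else 0) *
        (if x 2 = d then (1 : ℝ) else 0)
      - (if x 0 = a then (1 : ℝ) else 0) * (if x 1 = d then (1 : ℝ) else 0) *
        (if x 2 = c then (1 : ℝ) else 0)
      - (if x 0 = c then (1 : ℝ) else 0) * (if x 1 = a then (1 : ℝ) else 0) *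
        (if x 2 = d then (1 : ℝ) else 0)
      + (if x 0 = c then (1 : ℝ) else 0) * (if x 1 = d then (1 : ℝ) else 0) *
        (if x 2 = a then (1 : ℝ) else 0)
      + (if x 0 = d then (1 : ℝ) else 0) * (if x 1 = a then (1 : ℝ) else 0) *
        (if x 2 = c then (1 : ℝ) else 0)
      - (if x 0 = d then (1 : ℝ) else 0) * (if x 1 = c then (1 : ℝ) else 0) *
        (if x 2 = a then (1 : ℝ) else 0) := by
  have h (i j : Fin 7) : b.coord i (b j) = if i = j then (1 : ℝ) else 0 := by
    simp [Finsupp.single_apply, eq_comm]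
  rw [coordForm_apply, Matrix.det_fin_three]
  simp only [← h]
  rfl

/-- Each of the six permutations of the triple contributes the same amount, its sign being absorbed
by the antisymmetry of `F`. The 6 cancels the `1/3!` of the Hodge star. -/
theorem sum_coordForm_mul (x : Fin 3 → Fin 7)
    (F : Fin 7 → Fin 7 → Fin 7 → ℝ) (h₁ : ∀ a c d, F a c d = -F c a d)
    (h₂ : ∀ a c d, F a c d = -F a d c) :
    ∑ a, ∑ c, ∑ d, coordForm b x ![b a, b c, b d] * F a c d = 6 * F (x 0) (x 1) (x 2) := by
  have e1 : F (x 0) (x 2) (x 1) = -F (x 0) (x 1) (x 2) := h₂ ..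
  have e2 : F (x 1) (x 0) (x 2) = -F (x 0) (x 1) (x 2) := h₁ ..
  have e3 : F (x 1) (x 2) (x 0) = F (x 0) (x 1) (x 2) := by rw [h₂, e2, neg_neg]
  have e4 : F (x 2) (x 0) (x 1) = F (x 0) (x 1) (x 2) := by rw [h₁, e1, neg_neg]
  have e5 : F (x 2) (x 1) (x 0) = -F (x 0) (x 1) (x 2) := by rw [h₂, e4]
  simp only [coordForm_triple]
  simp [sub_mul, add_mul, Finset.sum_add_distrib, Finset.sum_sub_distrib, ite_mul,
    e1, e2, e3, e4, e5]
  ring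

theorem dualForm_stdForm_apply (v : Fin 4 → V) : dualForm (stdForm b) b v = ∑ s, (stdCoeff s : ℝ) *
    b.det (Matrix.vecCons (b (stdTriple s 0)) (Matrix.vecCons (b (stdTriple s 1))
      (Matrix.vecCons (b (stdTriple s 2)) v))) := by
  have h1 (a c d : Fin 7) : (∑ p, ∑ q, ∑ r, stdForm b ![b p, b q, b r] *
      ((1 : Matrix (Fin 7) (Fin 7) ℝ) p a * (1 : Matrix (Fin 7) (Fin 7) ℝ) q c *
        (1 : Matrix (Fin 7) (Fin 7) ℝ) r d)) = stdForm b ![b a, b c, b d] := by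
    simp [Matrix.one_apply]
  let F (a c d : Fin 7) : ℝ := interior (b d) (interior (b c) (interior (b a) b.det)) v
  have hF (a c d : Fin 7) : F a c d =
      b.det (Matrix.vecCons (b a) (Matrix.vecCons (b c) (Matrix.vecCons (b d) v))) := by
    simp only [F]
    rw [interior_apply, interior_apply, interior_apply]
  have hF₁ (a c d : Fin 7) : F a c d = -F c a d := by
    simp only [F]
    rw [interior_interior_comm (b c)]
    rfl
  have hF₂ (a c d : Fin 7) : F a c d = -F a d c := by
    simp only [F]
    rw [interior_interior_comm (b d)]
    rfl
  unfold dualForm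
  rw [metricInv_stdForm, volForm_stdForm]
  simp only [h1]
  have h2 (a c d : Fin 7) : stdForm b ![b a, b c, b d] =
      ∑ s, (stdCoeff s : ℝ) * coordForm b (stdTriple s) ![b a, b c, b d] := by
    rw [stdForm, form_sum_apply]; rfl
  have h3 : ∑ a, ∑ c, ∑ d, stdForm b ![b a, b c, b d] * F a c d =
      ∑ s, (stdCoeff s : ℝ) * (6 * F (stdTriple s 0) (stdTriple s 1) (stdTriple s 2)) := by
    simp only [← sum_coordForm_mul b _ F hF₁ hF₂, h2, Finset.sum_mul, Finset.mul_sum, mul_assoc]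
    symm
    rw [Finset.sum_comm]
    refine Finset.sum_congr rfl fun a _ => ?_
    rw [Finset.sum_comm]
    refine Finset.sum_congr rfl fun c _ => ?_
    rw [Finset.sum_comm]
  rw [AlternatingMap.smul_apply]
  simp only [form_sum_apply, AlternatingMap.smul_apply, smul_eq_mul]
  refine (congrArg ((1 / 6 : ℝ) * ·) h3).trans ?_
  simp only [Finset.mul_sum]
  refine Finset.sum_congr rfl fun s _ => ?_
  have h6 (r y : ℝ) : 1 / 6 * (r * (6 * y)) = r * y := by ring
  rw [h6, hF]

/-! ### The action of endomorphisms on `3`-forms -/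

/-- The index `d` of the only nonzero component `φ_acd` of the standard positive form with given
indices `a ≠ c`. -/
def stdCross : Fin 7 → Fin 7 → Fin 7 :=
  ![![0, 2, 1, 4, 3, 6, 5],
    ![2, 0, 0, 5, 6, 3, 4],
    ![1, 0, 0, 6, 5, 4, 3],
    ![4, 5, 6, 0, 0, 1, 2],
    ![3, 6, 5, 0, 0, 2, 1],
    ![6, 3, 4, 1, 2, 0, 0],
    ![5, 4, 3, 2, 1, 0, 0]]

/-- The nonzero component `φ_acd` of the standard positive form with given indices `a ≠ c`. -/
def stdSign : Fin 7 → Fin 7 → ℤ :=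
  ![![0, 1, -1, 1, -1, -1, 1],
    ![-1, 0, 1, 1, 1, -1, -1],
    ![1, -1, 0, 1, -1, 1, -1],
    ![-1, -1, -1, 0, 1, 1, 1],
    ![1, -1, 1, -1, 0, -1, 1],
    ![1, 1, -1, -1, 1, 0, -1],
    ![-1, 1, 1, -1, -1, 1, 0]]

/-- The components of the standard positive form. -/
def stdPhi (a c d : Fin 7) : ℤ := if stdCross a c = d then stdSign a c else 0

/-- Two distinct indices have exactly one partner. The diagonal entries of `stdCross` are dummies,
annihilated by the zeros of `stdSign`. -/
theorem sum_stdPhi_mul (a c : Fin 7) (f : Fin 7 → ℤ) :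
    ∑ d, stdPhi a c d * f d = stdSign a c * f (stdCross a c) := by
  simp [stdPhi]

theorem stdPhi_eq : ∀ a c d, stdPhi a c d = ∑ s, stdCoeff s *
      ((if stdTriple s 0 = a then 1 else 0) * (if stdTriple s 1 = c then 1 else 0) *
        (if stdTriple s 2 = d then 1 else 0)
      - (if stdTriple s 0 = a then 1 else 0) * (if stdTriple s 1 = d then 1 else 0) *
        (if stdTriple s 2 = c then 1 else 0)
      - (if stdTriple s 0 = c then 1 else 0) * (if stdTriple s 1 = a then 1 else 0) *
        (if stdTriple s 2 = d then 1 else 0)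
      + (if stdTriple s 0 = c then 1 else 0) * (if stdTriple s 1 = d then 1 else 0) *
        (if stdTriple s 2 = a then 1 else 0)
      + (if stdTriple s 0 = d then 1 else 0) * (if stdTriple s 1 = a then 1 else 0) *
        (if stdTriple s 2 = c then 1 else 0)
      - (if stdTriple s 0 = d then 1 else 0) * (if stdTriple s 1 = c then 1 else 0) *
        (if stdTriple s 2 = a then 1 else 0)) := by
  decide +kernel

theorem stdPhi_swap : ∀ a c d, stdPhi a d c = -stdPhi a c d := by
  decide +kernel

theorem stdForm_triple (a c d : Fin 7) : stdForm b ![b a, b c, b d] = stdPhi a c d := by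
  rw [stdForm, form_sum_apply, stdPhi_eq]
  push_cast
  refine Finset.sum_congr rfl fun s _ => ?_
  rw [AlternatingMap.smul_apply, coordForm_triple, smul_eq_mul]

/-- The components of the dual of the standard positive form. -/
def stdPsi (m i j k : Fin 7) : ℤ := ∑ s, stdCoeff s *
  epsList [stdTriple s 0, stdTriple s 1, stdTriple s 2, m, i, j, k]

theorem dualForm_stdForm_frame (m i j k : Fin 7) :
    dualForm (stdForm b) b ![b m, b i, b j, b k] = stdPsi m i j k := by
  rw [dualForm_stdForm_apply, stdPsi]
  push_cast
  refine Finset.sum_congr rfl fun s _ => ?_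
  congr 1
  let y : Fin 7 → Fin 7 := ![stdTriple s 0, stdTriple s 1, stdTriple s 2, m, i, j, k]
  have h := det_basis b y
  rw [← show (fun p => b (y p)) = Matrix.vecCons (b (stdTriple s 0)) (Matrix.vecCons
    (b (stdTriple s 1)) (Matrix.vecCons (b (stdTriple s 2)) ![b m, b i, b j, b k])) from ?_]
  · exact h
  · ext p
    fin_cases p <;> rfl

/-- The action on `φ` of the skew endomorphism obtained by contracting `φ` with a vector is a
multiple of that vector contracted with `ψ`. This is what realises the `X` term of the flow as an
endomorphism action. -/
theorem stdPhi_contract (m i j k : Fin 7) :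
    ∑ l, (stdPhi m i l * stdPhi l j k + stdPhi m j l * stdPhi i l k
      + stdPhi m k l * stdPhi i j l) = -3 * stdPsi m i j k := by
  -- Once the sum over `l` has collapsed to one term per product, the identity is a check over all
  -- quadruples of indices.
  have h : ∀ m i j k : Fin 7, stdSign m i * stdPhi (stdCross m i) j k +
      stdSign m j * stdPhi i (stdCross m j) k + stdSign m k * stdPhi i j (stdCross m k) =
      -3 * stdPsi m i j k := by
    decide +kernel
  rw [← h, Finset.sum_add_distrib, Finset.sum_add_distrib, sum_stdPhi_mul, sum_stdPhi_mul,
    sum_stdPhi_mul]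

end G2

end

noncomputable section

namespace G2

variable {V : Type*} [AddCommGroup V] [Module ℝ V]

/-! ### Change of frame -/

section ChangeOfFrame

variable (φ : V [⋀^Fin 3]→ₗ[ℝ] ℝ) (b b' : Module.Basis (Fin 7) ℝ V)

/-- The determinant of `B` acquires a ninth power: seven factors from the scalar on a 7×7 matrix,
two from the conjugating matrices. The ninth root thus has weight one. -/
theorem root9_det_tensorB_changeFrame :
    root9 (tensorB φ b').det = b.det b' * root9 (tensorB φ b).det := by
  rw [tensorB_changeFrame b φ b', Matrix.det_smul, Matrix.det_mul, Matrix.det_mul,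
    Matrix.det_transpose, ← Module.Basis.det_apply, Fintype.card_fin, ← root9_pow_mul]
  congr 1
  ring

theorem det_frame_ne_zero : b.det b' ≠ 0 := (b.isUnit_det b').ne_zero

theorem metric_eq_smul : metric φ b =
    (1 / (6 : ℝ) ^ ((2 : ℝ) / 9) / root9 (tensorB φ b).det) • tensorB φ b := by
  ext i j
  rw [metric, Matrix.of_apply, Matrix.smul_apply, smul_eq_mul]
  ring

/-- The weight of `B` and that of the ninth root cancel, leaving the law of a bilinear form. -/
theorem metric_changeFrame :
    metric φ b' = (b.toMatrix b').transpose * metric φ b * b.toMatrix b' := by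
  rw [metric_eq_smul, metric_eq_smul, root9_det_tensorB_changeFrame φ b b',
    tensorB_changeFrame b φ b', smul_smul, Matrix.mul_smul, Matrix.smul_mul]
  congr 1
  have := det_frame_ne_zero b b'
  field_simp

theorem metricInv_changeFrame :
    metricInv φ b' = b'.toMatrix b * metricInv φ b * (b'.toMatrix b).transpose := by
  have h : (b.toMatrix b')⁻¹ = b'.toMatrix b :=
    Matrix.inv_eq_left_inv (b'.toMatrix_mul_toMatrix_flip b)
  rw [metricInv, metric_changeFrame φ b b', Matrix.mul_inv_rev, Matrix.mul_inv_rev,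
    ← Matrix.transpose_nonsing_inv, h, metricInv, Matrix.mul_assoc]

theorem volForm_changeFrame : volForm φ b' = volForm φ b := by
  have h : b.det = b.det b' • b'.det := b.det.eq_smul_basis_det b'
  unfold volForm
  rw [root9_det_tensorB_changeFrame φ b b']
  conv_rhs => rw [h]
  rw [smul_smul]
  congr 1
  ring

/-- The contraction of a bilinear expression with the inverse metric. -/
def contract (F : V → V → ℝ) : ℝ := ∑ p, ∑ a, metricInv φ b p a * F (b p) (b a)

/-- The contraction is the trace of the inverse metric times the transposed matrix of `F`; the
transition matrices cancel under the cyclic trace. -/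
theorem contract_changeFrame (F : V → V → ℝ) (h₁ : ∀ w, IsLinearMap ℝ fun u => F u w)
    (h₂ : ∀ u, IsLinearMap ℝ (F u)) : contract φ b' F = contract φ b F := by
  let Q : LinearMap.BilinForm ℝ V := LinearMap.mk₂ ℝ F (fun u u' w => (h₁ w).map_add u u')
    (fun c u w => (h₁ w).map_smul c u) (fun u w w' => (h₂ u).map_add w w')
    (fun c u w => (h₂ u).map_smul c w)
  have hQ (u w : V) : F u w = Q u w := rfl
  have key (b : Module.Basis (Fin 7) ℝ V) :
      contract φ b F = (metricInv φ b * (LinearMap.BilinForm.toMatrix b Q).transpose).trace := by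
    simp only [contract, Matrix.trace, Matrix.diag_apply, Matrix.mul_apply,
      Matrix.transpose_apply, LinearMap.BilinForm.toMatrix_apply, hQ]
  have hP := b'.toMatrix_mul_toMatrix_flip b
  have hM : LinearMap.BilinForm.toMatrix b Q = (b'.toMatrix b).transpose *
      LinearMap.BilinForm.toMatrix b' Q * b'.toMatrix b :=
    (LinearMap.BilinForm.toMatrix_mul_basis_toMatrix (b := b') b Q).symm
  rw [key, key, metricInv_changeFrame φ b b', hM]
  simp only [Matrix.transpose_mul, Matrix.transpose_transpose]
  rw [Matrix.mul_assoc, Matrix.mul_assoc, Matrix.trace_mul_comm]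
  simp only [Matrix.mul_assoc]

theorem isLinearMap_contract (F : V → V → V → ℝ)
    (h : ∀ u w, IsLinearMap ℝ fun z => F z u w) :
    IsLinearMap ℝ fun z => contract φ b (F z) := by
  constructor
  · intro x y
    simp only [contract, (h _ _).map_add, mul_add, Finset.sum_add_distrib]
  · intro c x
    simp only [contract, (h _ _).map_smul, smul_eq_mul, Finset.mul_sum]
    refine Finset.sum_congr rfl fun p _ => Finset.sum_congr rfl fun a _ => ?_
    ring

theorem sum_six_comm {ι : Type*} [Fintype ι] (f : ι → ι → ι → ι → ι → ι → ℝ) :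
    ∑ a, ∑ c, ∑ d, ∑ p, ∑ q, ∑ r, f a c d p q r =
      ∑ p, ∑ a, ∑ q, ∑ c, ∑ r, ∑ d, f a c d p q r := by
  symm
  rw [Finset.sum_comm]
  refine Finset.sum_congr rfl fun a _ => ?_
  refine (Finset.sum_congr rfl fun p _ => Finset.sum_comm).trans ?_
  rw [Finset.sum_comm]
  refine Finset.sum_congr rfl fun c _ => ?_
  refine (Finset.sum_congr rfl fun p _ => Finset.sum_congr rfl fun q _ =>
    Finset.sum_comm).trans ?_
  refine (Finset.sum_congr rfl fun p _ => Finset.sum_comm).trans ?_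
  rw [Finset.sum_comm]

theorem dualForm_apply (v : Fin 4 → V) : dualForm φ b v = (1 / 6) *
    contract φ b fun u₁ w₁ => contract φ b fun u₂ w₂ => contract φ b fun u₃ w₃ =>
      φ ![u₁, u₂, u₃] * interior w₃ (interior w₂ (interior w₁ (volForm φ b))) v := by
  unfold dualForm
  rw [AlternatingMap.smul_apply]
  simp only [form_sum_apply, AlternatingMap.smul_apply, smul_eq_mul, Finset.sum_mul]
  rw [sum_six_comm]
  congr 1
  simp only [contract, Finset.mul_sum]
  refine Finset.sum_congr rfl fun p _ => Finset.sum_congr rfl fun a _ =>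
    Finset.sum_congr rfl fun q _ => Finset.sum_congr rfl fun c _ =>
    Finset.sum_congr rfl fun r _ => Finset.sum_congr rfl fun d _ => ?_
  ring

theorem contract_contract_contract_changeFrame (F : V → V → V → V → V → V → ℝ)
    (l₁ : ∀ w₁ u₂ w₂ u₃ w₃, IsLinearMap ℝ fun u₁ => F u₁ w₁ u₂ w₂ u₃ w₃)
    (m₁ : ∀ u₁ u₂ w₂ u₃ w₃, IsLinearMap ℝ fun w₁ => F u₁ w₁ u₂ w₂ u₃ w₃)
    (l₂ : ∀ u₁ w₁ w₂ u₃ w₃, IsLinearMap ℝ fun u₂ => F u₁ w₁ u₂ w₂ u₃ w₃)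
    (m₂ : ∀ u₁ w₁ u₂ u₃ w₃, IsLinearMap ℝ fun w₂ => F u₁ w₁ u₂ w₂ u₃ w₃)
    (l₃ : ∀ u₁ w₁ u₂ w₂ w₃, IsLinearMap ℝ fun u₃ => F u₁ w₁ u₂ w₂ u₃ w₃)
    (m₃ : ∀ u₁ w₁ u₂ w₂ u₃, IsLinearMap ℝ fun w₃ => F u₁ w₁ u₂ w₂ u₃ w₃) :
    (contract φ b' fun u₁ w₁ => contract φ b' fun u₂ w₂ => contract φ b' fun u₃ w₃ =>
      F u₁ w₁ u₂ w₂ u₃ w₃) =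
    contract φ b fun u₁ w₁ => contract φ b fun u₂ w₂ => contract φ b fun u₃ w₃ =>
      F u₁ w₁ u₂ w₂ u₃ w₃ := by
  have h₃ (u₁ w₁ u₂ w₂ : V) := contract_changeFrame φ b b' (F u₁ w₁ u₂ w₂)
    (fun w => l₃ _ _ _ _ _) (fun u => m₃ _ _ _ _ _)
  have h₂ (u₁ w₁ : V) := contract_changeFrame φ b b'
    (fun u₂ w₂ => contract φ b (F u₁ w₁ u₂ w₂))
    (fun w => isLinearMap_contract φ b _ fun _ _ => l₂ _ _ _ _ _)
    (fun u => isLinearMap_contract φ b _ fun _ _ => m₂ _ _ _ _ _)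
  simp only [h₃, h₂]
  exact contract_changeFrame φ b b'
    (fun u₁ w₁ => contract φ b fun u₂ w₂ => contract φ b (F u₁ w₁ u₂ w₂))
    (fun w => isLinearMap_contract φ b _ fun _ _ => isLinearMap_contract φ b _ fun _ _ =>
      l₁ _ _ _ _ _)
    (fun u => isLinearMap_contract φ b _ fun _ _ => isLinearMap_contract φ b _ fun _ _ =>
      m₁ _ _ _ _ _)

theorem isLinearMap_interior_apply {k : ℕ} (η : V [⋀^Fin (k + 1)]→ₗ[ℝ] ℝ) (v : Fin k → V) :
    IsLinearMap ℝ fun u => interior u η v :=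
  ⟨fun x y => η.map_vecCons_add v x y, fun c x => η.map_vecCons_smul v c x⟩

theorem isLinearMap_interior_interior_apply {k : ℕ} (w : V) (η : V [⋀^Fin (k + 2)]→ₗ[ℝ] ℝ)
    (v : Fin k → V) : IsLinearMap ℝ fun u => interior w (interior u η) v :=
  isLinearMap_interior_apply η (Matrix.vecCons w v)

theorem isLinearMap_interior_interior_interior_apply {k : ℕ} (w w' : V)
    (η : V [⋀^Fin (k + 3)]→ₗ[ℝ] ℝ) (v : Fin k → V) :
    IsLinearMap ℝ fun u => interior w' (interior w (interior u η)) v :=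
  isLinearMap_interior_apply η (Matrix.vecCons w (Matrix.vecCons w' v))

theorem _root_.IsLinearMap.mul_const {f : V → ℝ} (hf : IsLinearMap ℝ f) (c : ℝ) :
    IsLinearMap ℝ fun u => f u * c :=
  ⟨fun x y => by rw [hf.map_add, add_mul], fun r x => by rw [hf.map_smul, smul_mul_assoc]⟩

theorem _root_.IsLinearMap.const_mul {f : V → ℝ} (hf : IsLinearMap ℝ f) (c : ℝ) :
    IsLinearMap ℝ fun u => c * f u :=
  ⟨fun x y => by rw [hf.map_add, mul_add], fun r x => by rw [hf.map_smul, mul_smul_comm]⟩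

/-- The Hodge star is three metric contractions of a multilinear expression with an invariant volume
form. Hence `ψ`, used in a coordinate frame, can be computed in a standard one. -/
theorem dualForm_changeFrame : dualForm φ b' = dualForm φ b := by
  ext v
  rw [dualForm_apply, dualForm_apply, volForm_changeFrame φ b b']
  refine congrArg _ (contract_contract_contract_changeFrame φ b b'
    (fun u₁ w₁ u₂ w₂ u₃ w₃ =>
      φ ![u₁, u₂, u₃] * interior w₃ (interior w₂ (interior w₁ (volForm φ b))) v) ?_ ?_ ?_ ?_ ?_ ?_)
  · exact fun w₁ u₂ w₂ u₃ w₃ => (isLinearMap_interior_apply φ ![u₂, u₃]).mul_const _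
  · exact fun u₁ u₂ w₂ u₃ w₃ =>
      (isLinearMap_interior_interior_interior_apply w₂ w₃ (volForm φ b) v).const_mul _
  · exact fun u₁ w₁ w₂ u₃ w₃ => (isLinearMap_interior_apply (interior u₁ φ) ![u₃]).mul_const _
  · exact fun u₁ w₁ u₂ u₃ w₃ =>
      (isLinearMap_interior_interior_apply w₃ (interior w₁ (volForm φ b)) v).const_mul _
  · exact fun u₁ w₁ u₂ w₂ w₃ =>
      (isLinearMap_interior_apply (interior u₂ (interior u₁ φ)) ![]).mul_const _
  · exact fun u₁ w₁ u₂ w₂ u₃ =>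
      (isLinearMap_interior_apply (interior w₂ (interior w₁ (volForm φ b))) v).const_mul _

end ChangeOfFrame

/-! ### The action of endomorphisms on `3`-forms -/

/-- The derivation `(u, v, w) ↦ φ(Au, v, w) + φ(u, Av, w) + φ(u, v, Aw)`. -/
def endAction (A : V →ₗ[ℝ] V) (φ : V [⋀^Fin 3]→ₗ[ℝ] ℝ) : MultilinearMap ℝ (fun _ : Fin 3 => V) ℝ :=
  ∑ p, φ.toMultilinearMap.compLinearMap fun q => if q = p then A else LinearMap.id

theorem endAction_apply (A : V →ₗ[ℝ] V) (φ : V [⋀^Fin 3]→ₗ[ℝ] ℝ) (u v w : V) :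
    endAction A φ ![u, v, w] = φ ![A u, v, w] + φ ![u, A v, w] + φ ![u, v, A w] := by
  have h (p : Fin 3) : φ.toMultilinearMap.compLinearMap
      (fun q => if q = p then A else LinearMap.id) ![u, v, w] =
      φ fun q => (if q = p then A else LinearMap.id) ((![u, v, w] : Fin 3 → V) q) := rfl
  rw [endAction, _root_.sum_apply, Fin.sum_univ_three, h, h, h]
  congr 3 <;> ext q <;> fin_cases q <;> rfl

theorem endAction_frame (b : Module.Basis (Fin 7) ℝ V) (A : V →ₗ[ℝ] V)
    (φ : V [⋀^Fin 3]→ₗ[ℝ] ℝ) (i j k : Fin 7) : endAction A φ ![b i, b j, b k] =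
      ∑ l, (LinearMap.toMatrix b b A l i * φ ![b l, b j, b k] +
        LinearMap.toMatrix b b A l j * φ ![b i, b l, b k] +
        LinearMap.toMatrix b b A l k * φ ![b i, b j, b l]) := by
  have hA (i : Fin 7) : A (b i) = ∑ l, LinearMap.toMatrix b b A l i • b l := by
    conv_lhs => rw [← b.sum_repr (A (b i))]
    simp [LinearMap.toMatrix_apply]
  have h (f : V → ℝ) (hf : IsLinearMap ℝ f) (i : Fin 7) :
      f (A (b i)) = ∑ l, LinearMap.toMatrix b b A l i * f (b l) := by
    have := congrArg (hf.mk' f) (hA i)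
    rw [map_sum] at this
    simpa using this
  rw [endAction_apply, Finset.sum_add_distrib, Finset.sum_add_distrib,
    ← h (fun u => φ ![u, b j, b k]) (isLinearMap_interior_apply φ ![b j, b k]),
    ← h (fun u => φ ![b i, u, b k]) (isLinearMap_interior_apply (interior (b i) φ) ![b k]),
    ← h (fun u => φ ![b i, b j, u])
      (isLinearMap_interior_apply (interior (b j) (interior (b i) φ)) ![])]

theorem exists_skew_stdForm (b : Module.Basis (Fin 7) ℝ V) (X : V) : ∃ Y : V →ₗ[ℝ] V,
    (∀ v, interior X (dualForm (stdForm b) b) v = endAction Y (stdForm b) v) ∧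
    (LinearMap.toMatrix b b Y).transpose + LinearMap.toMatrix b b Y = 0 := by
  -- The factor `-1/3` inverts the `-3` of `stdPhi_contract`; skewness is the antisymmetry of `φ` in
  -- its last two indices.
  let Y : Matrix (Fin 7) (Fin 7) ℝ :=
    Matrix.of fun l i => -(1 / 3) * ∑ m, b.repr X m * (stdPhi m i l : ℝ)
  refine ⟨Matrix.toLin b b Y, ?_, ?_⟩
  · suffices h : (interior X (dualForm (stdForm b) b)).toMultilinearMap =
        endAction (Matrix.toLin b b Y) (stdForm b) from fun v => congrArg (fun f => f v) h
    refine Module.Basis.ext_multilinear (fun _ => b) fun x => ?_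
    have hx : (fun p => b (x p)) = ![b (x 0), b (x 1), b (x 2)] := by
      ext p; fin_cases p <;> rfl
    rw [hx, endAction_frame b, LinearMap.toMatrix_toLin]
    generalize x 0 = i
    generalize x 1 = j
    generalize x 2 = k
    have hl := isLinearMap_interior_apply (dualForm (stdForm b) b) ![b i, b j, b k]
    have h1 : interior X (dualForm (stdForm b) b) ![b i, b j, b k] =
        ∑ m, b.repr X m * (stdPsi m i j k : ℝ) := by
      have := congrArg (hl.mk' _) (b.sum_repr X).symm
      rw [map_sum] at this
      simp only [map_smul, IsLinearMap.mk'_apply, smul_eq_mul] at this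
      rw [this]
      refine Finset.sum_congr rfl fun m _ => ?_
      rw [← dualForm_stdForm_frame b]
      rfl
    have h2 (m : Fin 7) : (stdPsi m i j k : ℝ) = -(1 / 3) * ∑ l, ((stdPhi m i l : ℝ) * stdPhi l j k
        + (stdPhi m j l : ℝ) * stdPhi i l k + (stdPhi m k l : ℝ) * stdPhi i j l) := by
      have := congrArg (Int.cast : ℤ → ℝ) (stdPhi_contract m i j k)
      push_cast at this
      rw [this]
      ring
    refine h1.trans ?_
    simp only [h2, stdForm_triple, Y, Matrix.of_apply, Finset.mul_sum, Finset.sum_mul,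
      ← Finset.sum_add_distrib]
    rw [Finset.sum_comm]
    refine Finset.sum_congr rfl fun l _ => Finset.sum_congr rfl fun m _ => ?_
    ring
  · rw [LinearMap.toMatrix_toLin]
    ext i j
    simp only [Y, Matrix.add_apply, Matrix.transpose_apply, Matrix.of_apply, Matrix.zero_apply,
      Finset.mul_sum, ← Finset.sum_add_distrib]
    refine Finset.sum_eq_zero fun m _ => ?_
    rw [stdPhi_swap m i j]
    push_cast
    ring

/-- The interior product of a vector with the dual form is the action of an endomorphism which is
skew for the metric. -/
theorem IsPositive.exists_skew {φ : V [⋀^Fin 3]→ₗ[ℝ] ℝ} (hφ : IsPositive φ)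
    (b : Module.Basis (Fin 7) ℝ V) (X : V) : ∃ Y : V →ₗ[ℝ] V,
    (∀ v, interior X (dualForm φ b) v = endAction Y φ v) ∧ (LinearMap.toMatrix b b Y).trace = 0 ∧
    (LinearMap.toMatrix b b Y).transpose * tensorB φ b +
      tensorB φ b * LinearMap.toMatrix b b Y = 0 := by
  obtain ⟨b₀, rfl⟩ := hφ.exists_eq_stdForm
  obtain ⟨Y, hY, hs⟩ := exists_skew_stdForm b₀ X
  have hPQ := b₀.toMatrix_mul_toMatrix_flip b
  have hQP := b.toMatrix_mul_toMatrix_flip b₀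
  have hM : LinearMap.toMatrix b b Y =
      b.toMatrix b₀ * LinearMap.toMatrix b₀ b₀ Y * b₀.toMatrix b :=
    (basis_toMatrix_mul_linearMap_toMatrix_mul_basis_toMatrix b b₀ b b₀ Y).symm
  refine ⟨Y, fun v => ?_, ?_, ?_⟩
  · rw [dualForm_changeFrame _ b₀ b, hY]
  · have := congrArg Matrix.trace hs
    rw [Matrix.trace_add, Matrix.trace_transpose, Matrix.trace_zero, ← two_mul] at this
    rw [hM, Matrix.trace_mul_comm, ← Matrix.mul_assoc, hPQ, Matrix.one_mul]
    simpa using this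
  · rw [tensorB_changeFrame b₀ _ b, hM, tensorB_stdForm]
    generalize b₀.toMatrix b = P at *
    generalize b.toMatrix b₀ = Q at *
    generalize LinearMap.toMatrix b₀ b₀ Y = A at *
    have hPQ' : Q.transpose * P.transpose = 1 := by
      rw [← Matrix.transpose_mul, hPQ, Matrix.transpose_one]
    -- In the frame `b`, `B` is a multiple of `Pᵀ P` and `Y` has matrix `Q A P`. Cancelling `P Q =
    -- 1` leaves `Aᵀ + A` between `Pᵀ` and `P`.
    calc _ = (b₀.det b * -6) • (P.transpose * (A.transpose * (Q.transpose * P.transpose) +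
          (P * Q) * A) * P) := by
            simp only [Matrix.transpose_mul, Matrix.mul_add, Matrix.add_mul, Matrix.mul_assoc,
              Matrix.mul_smul, Matrix.smul_mul, smul_smul, smul_add, Matrix.mul_one]
      _ = 0 := by
        rw [hPQ, hPQ', Matrix.mul_one, Matrix.one_mul, hs, Matrix.mul_zero, Matrix.zero_mul,
          smul_zero]

end G2

end

/-! ### Derivatives along curves of 3-forms. -/

noncomputable section

namespace G2

variable {V : Type*} [AddCommGroup V] [Module ℝ V]

/-- The components of a `3`-form in a frame. -/
def components (φ : V [⋀^Fin 3]→ₗ[ℝ] ℝ) (b : Module.Basis (Fin 7) ℝ V) : (Fin 3 → Fin 7) → ℝ :=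
  fun x => φ fun p => b (x p)

/-- By trilinearity each component is a cubic polynomial in `r`, with the derivation as linear
coefficient. -/
theorem hasDerivAt_components_compLinearMap (φ : V [⋀^Fin 3]→ₗ[ℝ] ℝ)
    (b : Module.Basis (Fin 7) ℝ V) (A : V →ₗ[ℝ] V) :
    HasDerivAt (fun r : ℝ => components (φ.compLinearMap (LinearMap.id + r • A)) b)
      (fun x => endAction A φ fun p => b (x p)) 0 := by
  rw [hasDerivAt_pi]
  intro x
  have hx : (fun p => b (x p)) = ![b (x 0), b (x 1), b (x 2)] := by
    ext p; fin_cases p <;> rfl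
  rw [hx, endAction_apply]
  generalize hu : b (x 0) = u
  generalize hv : b (x 1) = v
  generalize hw : b (x 2) = w
  have l₁ (y z : V) := isLinearMap_interior_apply φ ![y, z]
  have l₂ (y z : V) := isLinearMap_interior_apply (interior y φ) ![z]
  have l₃ (y z : V) := isLinearMap_interior_apply (interior z (interior y φ)) ![]
  have a₁ (r : ℝ) (u u' v w : V) : φ ![u + r • u', v, w] = φ ![u, v, w] + r * φ ![u', v, w] :=
    ((l₁ v w).map_add _ _).trans (congrArg _ ((l₁ v w).map_smul _ _))
  have a₂ (r : ℝ) (u v v' w : V) : φ ![u, v + r • v', w] = φ ![u, v, w] + r * φ ![u, v', w] :=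
    ((l₂ u w).map_add _ _).trans (congrArg _ ((l₂ u w).map_smul _ _))
  have a₃ (r : ℝ) (u v w w' : V) : φ ![u, v, w + r • w'] = φ ![u, v, w] + r * φ ![u, v, w'] :=
    ((l₃ u v).map_add _ _).trans (congrArg _ ((l₃ u v).map_smul _ _))
  have e (r : ℝ) : components (φ.compLinearMap (LinearMap.id + r • A)) b x =
      φ ![u, v, w] + r * (φ ![A u, v, w] + φ ![u, A v, w] + φ ![u, v, A w])
        + r ^ 2 * (φ ![A u, A v, w] + φ ![A u, v, A w] + φ ![u, A v, A w]
          + r * φ ![A u, A v, A w]) := by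
    have : components (φ.compLinearMap (LinearMap.id + r • A)) b x =
        φ ![u + r • A u, v + r • A v, w + r • A w] := by
      subst hu hv hw
      refine congrArg φ ?_
      ext p; fin_cases p <;> rfl
    rw [this, a₁, a₂, a₂, a₃, a₃, a₃, a₃]
    ring
  simp only [e]
  generalize φ ![A u, v, w] + φ ![u, A v, w] + φ ![u, v, A w] = c
  generalize φ ![A u, A v, w] + φ ![A u, v, A w] + φ ![u, A v, A w] = c'
  have h := (((hasDerivAt_id (0 : ℝ)).mul_const c).const_add (φ ![u, v, w])).add
    (((hasDerivAt_id (0 : ℝ)).pow 2).mul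
      (((hasDerivAt_id (0 : ℝ)).mul_const (φ ![A u, A v, A w])).const_add c'))
  refine (h.congr_deriv ?_)
  simp

/-- A function of the components has the same derivative along a flow of `3`-forms as along any
curve of pullbacks with the same velocity. -/
theorem hasDerivWithinAt_of_endAction {φ : ℝ → V [⋀^Fin 3]→ₗ[ℝ] ℝ}
    {b : Module.Basis (Fin 7) ℝ V} {A : V →ₗ[ℝ] V} {J : Set ℝ} {t : ℝ}
    (hφ : HasDerivWithinAt (fun s => components (φ s) b)
      (fun x => endAction A (φ t) fun p => b (x p)) J t)
    {F : ((Fin 3 → Fin 7) → ℝ) → ℝ} (hF : Differentiable ℝ F) {d : ℝ}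
    (hd : HasDerivAt (fun r : ℝ =>
      F (components ((φ t).compLinearMap (LinearMap.id + r • A)) b)) d 0) :
    HasDerivWithinAt (fun s => F (components (φ s) b)) d J t := by
  have h0 : components ((φ t).compLinearMap (LinearMap.id + (0 : ℝ) • A)) b =
      components (φ t) b := by
    rw [zero_smul, add_zero, AlternatingMap.compLinearMap_id]
  have h1 := (hF (components (φ t) b)).hasFDerivAt
  have h2 := h1.comp_hasDerivWithinAt t hφ
  rw [← h0] at h1
  have h3 := h1.comp_hasDerivAt (0 : ℝ) (hasDerivAt_components_compLinearMap (φ t) b A)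
  rw [h0] at h3
  -- Both derivatives apply the differential of `F` to the same velocity. Uniqueness is invoked only
  -- for the model curve, defined on all of `ℝ`, so nothing is required of `J` at `t`.
  exact h2.congr_deriv (h3.unique hd)

theorem hasDerivAt_det_one_add_smul (A : Matrix (Fin 7) (Fin 7) ℝ) :
    HasDerivAt (fun r : ℝ => (1 + r • A).det) A.trace 0 := by
  rw [funext fun r : ℝ => Matrix.det_one_add_smul r A]
  have h := (((hasDerivAt_id (0 : ℝ)).const_mul A.trace).const_add 1).add
    (((Matrix.det (1 + (Polynomial.X : Polynomial ℝ) • A.map Polynomial.C)).divX.divX.hasDerivAt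
      (0 : ℝ)).mul ((hasDerivAt_id (0 : ℝ)).pow 2))
  refine h.congr_deriv ?_
  simp

theorem hasDerivAt_conj_apply (A B : Matrix (Fin 7) (Fin 7) ℝ) (i j : Fin 7) :
    HasDerivAt (fun r : ℝ => ((1 + r • A).transpose * B * (1 + r • A)) i j)
      ((A.transpose * B + B * A) i j) 0 := by
  have e (r : ℝ) : ((1 + r • A).transpose * B * (1 + r • A)) i j =
      B i j + r * (A.transpose * B + B * A) i j + r ^ 2 * (A.transpose * B * A) i j := by
    have : (1 + r • A).transpose * B * (1 + r • A) =
        B + r • (A.transpose * B + B * A) + r ^ 2 • (A.transpose * B * A) := by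
      simp only [Matrix.transpose_add, Matrix.transpose_one, Matrix.transpose_smul,
        Matrix.add_mul, Matrix.mul_add, Matrix.one_mul, Matrix.mul_one, Matrix.smul_mul,
        Matrix.mul_smul, smul_smul, smul_add, pow_two]
      abel
    rw [this]; rfl
  simp only [e]
  have h := (((hasDerivAt_id (0 : ℝ)).mul_const ((A.transpose * B + B * A) i j)).const_add
    (B i j)).add (((hasDerivAt_id (0 : ℝ)).pow 2).mul_const ((A.transpose * B * A) i j))
  refine h.congr_deriv ?_
  simp

theorem tensorB_compLinearMap_id_add_smul (φ : V [⋀^Fin 3]→ₗ[ℝ] ℝ)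
    (b : Module.Basis (Fin 7) ℝ V) (A : V →ₗ[ℝ] V) (r : ℝ) :
    tensorB (φ.compLinearMap (LinearMap.id + r • A)) b =
      (1 + r • LinearMap.toMatrix b b A).det • ((1 + r • LinearMap.toMatrix b b A).transpose *
        tensorB φ b * (1 + r • LinearMap.toMatrix b b A)) := by
  have h : LinearMap.toMatrix b b (LinearMap.id + r • A) = 1 + r • LinearMap.toMatrix b b A := by
    rw [map_add, map_smul, LinearMap.toMatrix_id]
  rw [tensorB_compLinearMap, h]

section Flow

variable {φ : ℝ → V [⋀^Fin 3]→ₗ[ℝ] ℝ} {b : Module.Basis (Fin 7) ℝ V} {A : V →ₗ[ℝ] V}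
  {J : Set ℝ} {t : ℝ}

theorem hasDerivWithinAt_tensorB (hφ : HasDerivWithinAt (fun s => components (φ s) b)
      (fun x => endAction A (φ t) fun p => b (x p)) J t) (i j : Fin 7) :
    HasDerivWithinAt (fun s => tensorB (φ s) b i j)
      (((LinearMap.toMatrix b b A).trace • tensorB (φ t) b +
        ((LinearMap.toMatrix b b A).transpose * tensorB (φ t) b +
          tensorB (φ t) b * LinearMap.toMatrix b b A)) i j) J t := by
  obtain ⟨F, hF, hFφ⟩ := exists_tensorB_eq b i j
  have hc (φ : V [⋀^Fin 3]→ₗ[ℝ] ℝ) : F (components φ b) = tensorB φ b i j := (hFφ φ).symm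
  have h := hasDerivWithinAt_of_endAction hφ hF (d :=
    ((LinearMap.toMatrix b b A).trace • tensorB (φ t) b +
        ((LinearMap.toMatrix b b A).transpose * tensorB (φ t) b +
          tensorB (φ t) b * LinearMap.toMatrix b b A)) i j) ?_
  · simpa only [hc] using h
  · simp only [hc, tensorB_compLinearMap_id_add_smul]
    refine ((hasDerivAt_det_one_add_smul (LinearMap.toMatrix b b A)).mul
      (hasDerivAt_conj_apply (LinearMap.toMatrix b b A) (tensorB (φ t) b) i j)).congr_deriv ?_
    simp

/-- Along the model curve `det B` is multiplied by `det(1 + rA)^9`, again as 7 + 2 factors. -/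
theorem hasDerivWithinAt_det_tensorB (hφ : HasDerivWithinAt (fun s => components (φ s) b)
      (fun x => endAction A (φ t) fun p => b (x p)) J t) :
    HasDerivWithinAt (fun s => (tensorB (φ s) b).det)
      (9 * (LinearMap.toMatrix b b A).trace * (tensorB (φ t) b).det) J t := by
  choose F hF hFφ using fun i j => exists_tensorB_eq b i j
  have hc (φ : V [⋀^Fin 3]→ₗ[ℝ] ℝ) :
      (Matrix.of fun i j => F i j (components φ b)).det = (tensorB φ b).det := by
    have : (Matrix.of fun i j => F i j (components φ b)) = tensorB φ b := by
      ext i j; exact (hFφ i j φ).symm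
    rw [this]
  have h := hasDerivWithinAt_of_endAction hφ
    (F := fun c => (Matrix.of fun i j => F i j c).det) ?_
    (d := 9 * (LinearMap.toMatrix b b A).trace * (tensorB (φ t) b).det) ?_
  · simpa only [hc] using h
  · simp only [Matrix.det_apply', Matrix.of_apply]
    fun_prop
  · simp only [hc, tensorB_compLinearMap_id_add_smul]
    have e (r : ℝ) : ((1 + r • LinearMap.toMatrix b b A).det •
        ((1 + r • LinearMap.toMatrix b b A).transpose * tensorB (φ t) b *
          (1 + r • LinearMap.toMatrix b b A))).det =
        (1 + r • LinearMap.toMatrix b b A).det ^ 9 * (tensorB (φ t) b).det := by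
      rw [Matrix.det_smul, Matrix.det_mul, Matrix.det_mul, Matrix.det_transpose, Fintype.card_fin]
      ring
    simp only [e]
    refine (((hasDerivAt_det_one_add_smul (LinearMap.toMatrix b b A)).pow 9).mul_const
      _).congr_deriv ?_
    simp

/-- This form of the derivative is the same for both signs of `y`, and its 9 cancels that of the
derivative of `det B`. -/
theorem hasDerivAt_root9 {y : ℝ} (hy : y ≠ 0) : HasDerivAt root9 (root9 y / (9 * y)) y := by
  have hpos (y : ℝ) (hy : 0 < y) : root9 y = y ^ ((1 : ℝ) / 9) := by
    rw [root9, sign_pos hy, abs_of_pos hy]; simp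
  have hneg (y : ℝ) (hy : y < 0) : root9 y = -(-y) ^ ((1 : ℝ) / 9) := by
    rw [root9, sign_neg hy, abs_of_neg hy]; simp
  rcases lt_or_gt_of_ne hy with h | h
  · have h1 := ((hasDerivAt_neg y).rpow_const (p := (1 : ℝ) / 9) (Or.inl (neg_ne_zero.2 hy))).neg
    have h2 := h1.congr_of_eventuallyEq (f₁ := root9)
      (Filter.eventually_of_mem (Iio_mem_nhds h) fun z hz => hneg z hz)
    refine h2.congr_deriv ?_
    rw [hneg y h, Real.rpow_sub_one (neg_ne_zero.2 hy)]
    field_simp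
  · have h1 := (hasDerivAt_id y).rpow_const (p := (1 : ℝ) / 9) (Or.inl hy)
    have h2 := h1.congr_of_eventuallyEq (f₁ := root9)
      (Filter.eventually_of_mem (Ioi_mem_nhds h) fun z hz => hpos z hz)
    refine h2.congr_deriv ?_
    rw [hpos y h, id, Real.rpow_sub_one hy]
    field_simp

theorem hasDerivWithinAt_root9_det_tensorB (hφ : HasDerivWithinAt (fun s => components (φ s) b)
      (fun x => endAction A (φ t) fun p => b (x p)) J t) (h0 : (tensorB (φ t) b).det ≠ 0) :
    HasDerivWithinAt (fun s => root9 (tensorB (φ s) b).det)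
      ((LinearMap.toMatrix b b A).trace * root9 (tensorB (φ t) b).det) J t := by
  refine ((hasDerivAt_root9 h0).comp_hasDerivWithinAt t
    (hasDerivWithinAt_det_tensorB hφ)).congr_deriv ?_
  field_simp

theorem hasDerivWithinAt_volForm (hφ : HasDerivWithinAt (fun s => components (φ s) b)
      (fun x => endAction A (φ t) fun p => b (x p)) J t) (h0 : (tensorB (φ t) b).det ≠ 0)
    (v : Fin 7 → V) : HasDerivWithinAt (fun s => volForm (φ s) b v)
      ((LinearMap.toMatrix b b A).trace * volForm (φ t) b v) J t := by
  simp only [volForm, AlternatingMap.smul_apply, smul_eq_mul]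
  refine (((hasDerivWithinAt_root9_det_tensorB hφ h0).const_mul _).mul_const _).congr_deriv ?_
  ring

theorem root9_ne_zero {y : ℝ} (hy : y ≠ 0) : root9 y ≠ 0 :=
  mul_ne_zero (by rcases lt_or_gt_of_ne hy with h | h <;> simp [sign_neg, sign_pos, h])
    (Real.rpow_pos_of_pos (abs_pos.2 hy) _).ne'

/-- In the quotient of `B` by the ninth root, the two `tr A` contributions cancel. -/
theorem hasDerivWithinAt_metric (hφ : HasDerivWithinAt (fun s => components (φ s) b)
      (fun x => endAction A (φ t) fun p => b (x p)) J t) (h0 : (tensorB (φ t) b).det ≠ 0)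
    (i j : Fin 7) : HasDerivWithinAt (fun s => metric (φ s) b i j)
      (((LinearMap.toMatrix b b A).transpose * metric (φ t) b +
        metric (φ t) b * LinearMap.toMatrix b b A) i j) J t := by
  have hr := root9_ne_zero h0
  have h := ((hasDerivWithinAt_tensorB hφ i j).div (hasDerivWithinAt_root9_det_tensorB hφ h0)
    hr).const_mul (1 / (6 : ℝ) ^ ((2 : ℝ) / 9))
  refine h.congr_deriv ?_
  rw [metric_eq_smul, Matrix.mul_smul, Matrix.smul_mul, ← smul_add, Matrix.add_apply,
    Matrix.smul_apply, Matrix.smul_apply, smul_eq_mul, smul_eq_mul]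
  field_simp
  ring

end Flow

theorem hasDerivWithinAt_inv_apply {G : ℝ → Matrix (Fin 7) (Fin 7) ℝ}
    {G' : Matrix (Fin 7) (Fin 7) ℝ} {J : Set ℝ} {t : ℝ}
    (hG : ∀ i j, HasDerivWithinAt (fun s => G s i j) (G' i j) J t) (h0 : (G t).det ≠ 0)
    (i j : Fin 7) :
    HasDerivWithinAt (fun s => (G s)⁻¹ i j) (-((G t)⁻¹ * G' * (G t)⁻¹) i j) J t := by
  -- An auxiliary Banach algebra norm, needed to differentiate inversion; the statement itself is
  -- entrywise.
  let _ : NormedRing (Matrix (Fin 7) (Fin 7) ℝ) := Matrix.linftyOpNormedRing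
  let _ : NormedAlgebra ℝ (Matrix (Fin 7) (Fin 7) ℝ) := Matrix.linftyOpNormedAlgebra
  have hd : HasDerivWithinAt G G' J t := by
    have h : HasDerivWithinAt (fun s => ∑ i, ∑ j, G s i j • Matrix.single i j (1 : ℝ))
        (∑ i, ∑ j, G' i j • Matrix.single i j (1 : ℝ)) J t :=
      HasDerivWithinAt.fun_sum fun i _ => HasDerivWithinAt.fun_sum fun j _ =>
        (hG i j).smul_const _
    have e (M : Matrix (Fin 7) (Fin 7) ℝ) :
        ∑ i, ∑ j, M i j • Matrix.single i j (1 : ℝ) = M := by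
      conv_rhs => rw [Matrix.matrix_eq_sum_single M]
      simp
    simpa only [e] using h
  let u : (Matrix (Fin 7) (Fin 7) ℝ)ˣ := Matrix.nonsingInvUnit (G t) (isUnit_iff_ne_zero.2 h0)
  have hu : (u : Matrix (Fin 7) (Fin 7) ℝ) = G t := rfl
  have hu' : ((u⁻¹ : (Matrix (Fin 7) (Fin 7) ℝ)ˣ) : Matrix (Fin 7) (Fin 7) ℝ) = (G t)⁻¹ := rfl
  have h1 : HasFDerivAt Ring.inverse _ (G t) := hasFDerivAt_ringInverse (𝕜 := ℝ) u
  have h2 := h1.comp_hasDerivWithinAt t hd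
  have h3 := (LinearMap.toContinuousLinearMap
    (Matrix.entryLinearMap ℝ ℝ i j)).hasFDerivAt.comp_hasDerivWithinAt t h2
  have e (s : ℝ) : (G s)⁻¹ i j = Matrix.entryLinearMap ℝ ℝ i j (Ring.inverse (G s)) := by
    rw [Matrix.nonsing_inv_eq_ringInverse]; rfl
  simp only [e]
  refine h3.congr_deriv ?_
  simp only [hu', _root_.neg_apply, ContinuousLinearMap.mulLeftRight_apply]
  rfl

/-! ### The general flow on one tangent space -/

theorem IsPositive.det_tensorB_ne_zero {φ : V [⋀^Fin 3]→ₗ[ℝ] ℝ} (hφ : IsPositive φ)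
    (b : Module.Basis (Fin 7) ℝ V) : (tensorB φ b).det ≠ 0 := by
  obtain ⟨b₀, rfl⟩ := hφ.exists_eq_stdForm
  rw [tensorB_changeFrame b₀ _ b, tensorB_stdForm, Matrix.det_smul, Matrix.det_mul,
    Matrix.det_mul, Matrix.det_transpose, Matrix.det_smul, Matrix.det_one,
    ← Module.Basis.det_apply]
  simp [det_frame_ne_zero b₀ b]

theorem IsPositive.det_metric_ne_zero {φ : V [⋀^Fin 3]→ₗ[ℝ] ℝ} (hφ : IsPositive φ)
    (b : Module.Basis (Fin 7) ℝ V) : (metric φ b).det ≠ 0 := by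
  obtain ⟨b₀, rfl⟩ := hφ.exists_eq_stdForm
  rw [metric_changeFrame _ b₀ b, metric_stdForm, Matrix.det_mul, Matrix.det_mul,
    Matrix.det_transpose, Matrix.det_one, ← Module.Basis.det_apply]
  simp [det_frame_ne_zero b₀ b]

theorem IsPositive.transpose_metric {φ : V [⋀^Fin 3]→ₗ[ℝ] ℝ} (hφ : IsPositive φ)
    (b : Module.Basis (Fin 7) ℝ V) : (metric φ b).transpose = metric φ b := by
  obtain ⟨b₀, rfl⟩ := hφ.exists_eq_stdForm
  rw [metric_changeFrame _ b₀ b, metric_stdForm]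
  simp [Matrix.transpose_mul]

theorem of_raiseOne (φ : V [⋀^Fin 3]→ₗ[ℝ] ℝ) (h : LinearMap.BilinForm ℝ V)
    (b : Module.Basis (Fin 7) ℝ V) :
    Matrix.of (raiseOne φ h b) = (metric φ b)⁻¹ * tensorComp h b := by
  ext l i
  rw [Matrix.of_apply, raiseOne, Matrix.mul_apply]; rfl

/-- The three `h` terms are by definition the action of the matrix `h^l_i`, and the action is
additive in the endomorphism. -/
theorem flowRHS_eq_endAction {φ : V [⋀^Fin 3]→ₗ[ℝ] ℝ} (h : LinearMap.BilinForm ℝ V) (X : V)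
    (b : Module.Basis (Fin 7) ℝ V) {Y : V →ₗ[ℝ] V}
    (hY : ∀ v, interior X (dualForm φ b) v = endAction Y φ v) (i j k : Fin 7) :
    flowRHS φ h X b i j k =
      endAction (Matrix.toLin b b (Matrix.of (raiseOne φ h b)) + Y) φ ![b i, b j, b k] := by
  have hX : interior X (dualForm φ b) ![b i, b j, b k] =
      ∑ l, b.repr X l * dualForm φ b ![b l, b i, b j, b k] := by
    have := congrArg ((isLinearMap_interior_apply (dualForm φ b) ![b i, b j, b k]).mk' _)
      (b.sum_repr X).symm
    rw [map_sum] at this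
    simp only [map_smul, IsLinearMap.mk'_apply, smul_eq_mul] at this
    exact this
  have hA : endAction (Matrix.toLin b b (Matrix.of (raiseOne φ h b)) + Y) φ ![b i, b j, b k] =
      endAction (Matrix.toLin b b (Matrix.of (raiseOne φ h b))) φ ![b i, b j, b k] +
        endAction Y φ ![b i, b j, b k] := by
    rw [endAction_frame b, endAction_frame b, endAction_frame b, ← Finset.sum_add_distrib, map_add]
    refine Finset.sum_congr rfl fun l _ => ?_
    simp only [Matrix.add_apply]
    ring
  rw [hA, ← hY, hX, endAction_frame b, LinearMap.toMatrix_toLin, ← Finset.sum_add_distrib]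
  rfl

/-- The evolution of `B`, of the metric, of the inverse metric and of the volume form under the
general flow, on one vector space. -/
theorem evolution_of_flow {φ : ℝ → V [⋀^Fin 3]→ₗ[ℝ] ℝ} (b : Module.Basis (Fin 7) ℝ V)
    (h : LinearMap.BilinForm ℝ V) (h_symm : ∀ u v, h u v = h v u) (X : V) {J : Set ℝ} {t : ℝ}
    (hpos : IsPositive (φ t))
    (hflow : ∀ i j k, HasDerivWithinAt (fun s => φ s ![b i, b j, b k])
      (flowRHS (φ t) h X b i j k) J t) :
    (∀ i j, HasDerivWithinAt (fun s => tensorB (φ s) b i j)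
      (traceG (φ t) h b * tensorB (φ t) b i j
        + ∑ l, raiseOne (φ t) h b l i * tensorB (φ t) b l j
        + ∑ l, raiseOne (φ t) h b l j * tensorB (φ t) b i l) J t) ∧
    (∀ i j, HasDerivWithinAt (fun s => metric (φ s) b i j) (2 * tensorComp h b i j) J t) ∧
    (∀ i j, HasDerivWithinAt (fun s => metricInv (φ s) b i j)
      (-2 * raiseTwo (φ t) h b i j) J t) ∧
    (∀ v, HasDerivWithinAt (fun s => volForm (φ s) b v)
      (traceG (φ t) h b * volForm (φ t) b v) J t) := by
  obtain ⟨Y, hY, hYtr, hYskew⟩ := hpos.exists_skew b X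
  let A := Matrix.toLin b b (Matrix.of (raiseOne (φ t) h b)) + Y
  have hd : HasDerivWithinAt (fun s => components (φ s) b)
      (fun x => endAction A (φ t) fun p => b (x p)) J t := by
    rw [hasDerivWithinAt_pi]
    intro x
    have hx : (fun p => b (x p)) = ![b (x 0), b (x 1), b (x 2)] := by
      ext p; fin_cases p <;> rfl
    simp only [components, hx]
    rw [← flowRHS_eq_endAction h X b hY]
    exact hflow _ _ _
  have hB0 := hpos.det_tensorB_ne_zero b
  have hG0 := hpos.det_metric_ne_zero b
  have hGt := hpos.transpose_metric b
  have hGu : IsUnit (metric (φ t) b).det := isUnit_iff_ne_zero.2 hG0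
  have hht : (tensorComp h b).transpose = tensorComp h b := by
    ext i j; exact h_symm _ _
  set H := Matrix.of (raiseOne (φ t) h b) with hH
  have hHG : H = (metric (φ t) b)⁻¹ * tensorComp h b := of_raiseOne _ _ _
  have hM : LinearMap.toMatrix b b A = H + LinearMap.toMatrix b b Y := by
    rw [map_add, LinearMap.toMatrix_toLin]
  have htr : (LinearMap.toMatrix b b A).trace = traceG (φ t) h b := by
    -- `h` is transposed to match the index order of `g^{ij} h_{ij}`.
    rw [hM, Matrix.trace_add, hYtr, add_zero, hHG, ← hht]
    simp only [Matrix.trace, Matrix.diag_apply, Matrix.mul_apply, Matrix.transpose_apply]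
    rfl
  have hskewG : (LinearMap.toMatrix b b Y).transpose * metric (φ t) b +
      metric (φ t) b * LinearMap.toMatrix b b Y = 0 := by
    rw [metric_eq_smul, Matrix.mul_smul, Matrix.smul_mul, ← smul_add, hYskew, smul_zero]
  have hB : (LinearMap.toMatrix b b A).transpose * tensorB (φ t) b +
      tensorB (φ t) b * LinearMap.toMatrix b b A =
      H.transpose * tensorB (φ t) b + tensorB (φ t) b * H := by
    rw [hM, Matrix.transpose_add, Matrix.add_mul, Matrix.mul_add, add_add_add_comm, hYskew,
      add_zero]
  -- With `H = g⁻¹ h`, both `g H` and `Hᵀ g` equal `h`, the latter by symmetry of `g` and `h`; this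
  -- gives the factor 2.
  have hg : (LinearMap.toMatrix b b A).transpose * metric (φ t) b +
      metric (φ t) b * LinearMap.toMatrix b b A = (2 : ℝ) • tensorComp h b := by
    rw [hM, Matrix.transpose_add, Matrix.add_mul, Matrix.mul_add, add_add_add_comm, hskewG,
      add_zero, hHG, Matrix.transpose_mul, Matrix.transpose_nonsing_inv, hGt, hht,
      Matrix.nonsing_inv_mul_cancel_right _ _ hGu, Matrix.mul_nonsing_inv_cancel_left _ _ hGu,
      two_smul]
  have hmetric (i j : Fin 7) : HasDerivWithinAt (fun s => metric (φ s) b i j)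
      (((2 : ℝ) • tensorComp h b) i j) J t := by
    rw [← hg]; exact hasDerivWithinAt_metric hd hB0 i j
  refine ⟨fun i j => ?_, hmetric, fun i j => ?_, fun v => ?_⟩
  · refine (hasDerivWithinAt_tensorB hd i j).congr_deriv ?_
    rw [hB, htr, Matrix.add_apply, Matrix.add_apply, Matrix.smul_apply, smul_eq_mul,
      Matrix.mul_apply, Matrix.mul_apply, add_assoc]
    simp only [Matrix.transpose_apply, hH, Matrix.of_apply, mul_comm]
  · refine (hasDerivWithinAt_inv_apply hmetric hG0 i j).congr_deriv ?_
    have hT : ((metric (φ t) b)⁻¹).transpose = (metric (φ t) b)⁻¹ := by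
      rw [Matrix.transpose_nonsing_inv, hGt]
    have e : raiseTwo (φ t) h b i j =
        ((metric (φ t) b)⁻¹ * tensorComp h b * (metric (φ t) b)⁻¹) i j := by
      simp only [raiseTwo, metricInv, Matrix.mul_apply, Finset.sum_mul]
      rw [Finset.sum_comm]
      refine Finset.sum_congr rfl fun q _ => Finset.sum_congr rfl fun p _ => ?_
      rw [← congrFun (congrFun hT q) j, Matrix.transpose_apply]
      ring
    rw [e, Matrix.mul_smul, Matrix.smul_mul, Matrix.smul_apply, smul_eq_mul, neg_mul]
  · rw [← htr]
    exact hasDerivWithinAt_volForm hd hB0 v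

end G2

end

/-- With `x` fixed, all the forms live on the same tangent space and the coordinate frame does not
depend on time, so the linear-algebra result applies directly. -/
theorem mainTheorem5 {M : Type*} [TopologicalSpace M]
    [ChartedSpace (EuclideanSpace ℝ (Fin 7)) M] [IsManifold (𝓡 7) ∞ M]
    (J : Set ℝ) (φ : ℝ → G2.G2Structure M)
    (h : ℝ → ∀ x : M, LinearMap.BilinForm ℝ (TangentSpace (𝓡 7) x))
    (h_symm : ∀ t ∈ J, ∀ (x : M) (u v : TangentSpace (𝓡 7) x), h t x u v = h t x v u)
    (X : ℝ → ∀ x : M, TangentSpace (𝓡 7) x)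
    (e : OpenPartialHomeomorph M (EuclideanSpace ℝ (Fin 7)))
    (he : e ∈ IsManifold.maximalAtlas (𝓡 7) ∞ M)
    (hflow : G2.IsGeneralFlow he J φ h X)
    (x : M) (hx : x ∈ e.source) (t : ℝ) (ht : t ∈ J) :
    (∀ i j : Fin 7,
      HasDerivWithinAt (fun s => G2.tensorB ((φ s).at x) (G2.coordFrame he hx) i j)
        (G2.traceG ((φ t).at x) (h t x) (G2.coordFrame he hx)
            * G2.tensorB ((φ t).at x) (G2.coordFrame he hx) i j
          + ∑ l, G2.raiseOne ((φ t).at x) (h t x) (G2.coordFrame he hx) l i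
            * G2.tensorB ((φ t).at x) (G2.coordFrame he hx) l j
          + ∑ l, G2.raiseOne ((φ t).at x) (h t x) (G2.coordFrame he hx) l j
            * G2.tensorB ((φ t).at x) (G2.coordFrame he hx) i l) J t) ∧
    (∀ i j : Fin 7,
      HasDerivWithinAt (fun s => G2.metric ((φ s).at x) (G2.coordFrame he hx) i j)
        (2 * G2.tensorComp (h t x) (G2.coordFrame he hx) i j) J t) ∧
    (∀ i j : Fin 7,
      HasDerivWithinAt (fun s => G2.metricInv ((φ s).at x) (G2.coordFrame he hx) i j)
        (-2 * G2.raiseTwo ((φ t).at x) (h t x) (G2.coordFrame he hx) i j) J t) ∧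
    (∀ v : Fin 7 → TangentSpace (𝓡 7) x,
      HasDerivWithinAt (fun s => G2.volForm ((φ s).at x) (G2.coordFrame he hx) v)
        (G2.traceG ((φ t).at x) (h t x) (G2.coordFrame he hx)
          * G2.volForm ((φ t).at x) (G2.coordFrame he hx) v) J t) :=
  G2.evolution_of_flow (G2.coordFrame he hx) (h t x) (h_symm t ht x) (X t x)
    ((φ t).positive x) fun i j k => hflow x hx t ht i j k
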